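/- \textbf{Setting.} Let $K,L,J,n_p,n_d\ge 1$ be integers with $n_p\le K$, let $n=n_p+n_d$, $M=2^J$, $P_p\ge 0$ and $P$ be reals with $n_pP_p\le nP$. All $K$ users are active, each has one antenna, and the base station has $L$ antennas. For $P'>0$ the pilot-assisted scheme is as follows; all the random objects below are independent. The pilots $b_1,\dots,b_K\in\mathbb C^{n_p}$ are uniform on the sphere of radius $\sqrt{n_pP_p}$, and $B=[b_1,\dots,b_K]$. The codebooks $(c_{k,m})_{m\in[M]}$, $k\in[K]$, have i.i.d. $\mathcal{CN}(0,P')$ entries and length $n_d$; $A\in\mathbb C^{n_d\times MK}$ is their concatenation. The messages $W_k$ are uniform on $[M]$. The fading matrix $H\in\mathbb C^{K\times L}$ and the noise matrices $Z_p\in\mathbb C^{n_p\times L}$, $Z_d\in\mathbb C^{n_d\times L}$ have i.i.d. $\mathcal{CN}(0,1)$ entries. User $k$ transmits its pilot and then $x_k=c_{k,W_k}$ if $\|c_{k,W_k}\|_2^2\le nP-n_pP_p$, and $x_k=0$ otherwise. The receiver observes $Y_p=BH+Z_p$ and $Y_d=[x_1,\dots,x_K]H+Z_d$, forms the MMSE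 estimate $\hat H=(I_K+B^HB)^{-1}B^HY_p$, and, knowing the pilots and the codebooks, outputs $(\hat W_k)_k$ that minimises $\|Y_d-[c_{1,\hat W_1},\dots,c_{K,\hat W_K}]\hat H\|_F^2$ over $[M]^K$ (ties are broken by any measurable rule). Let $P_e=P_e(P')=\frac1K\sum_{k=1}^K\mathbb P[W_k\ne\hat W_k]$. \textbf{Theorem.} For every $P'\in(0,P)$, $$P_e(P')\le p_0+\sum_{t=1}^K\frac tK\min\{1,p_t\},$$ and hence $\inf_{0<P'<P}P_e(P')\le\inf_{0<P'<P}\bigl\{p_0+\sum_{t=1}^K\frac tK\min\{1,p_t\}\bigr\}$. Here (all minima are understood as infima) $$p_0=K\left(1-\frac{\gamma\bigl(n_d,\frac{nP-n_pP_p}{P'}\bigr)}{\Gamma(n_d)}\right),\qquad p_t=\min_{\nu\ge0}\{q_{1,t}(\nu)+q_{2,t}(\nu)\},$$ $$q_{1,t}(\nu)=\binom Kt M^t\,\mathbb E_{A,B}\Bigl[\min_{u\ge0,\ r\ge0,\ \lambda_{\min}(D)>0}\exp\bigl\{rn_dL\nu-\tfrac L2\ln|D|\bigr\}\Bigr],$$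 $$q_{2,t}(\nu)=\min\Bigl\{\mathbb E_{A,B}\Bigl[\min_{0\le\delta<\frac1{1+\lambda_{\max}(\Theta)}}e^{-\delta n_dL\nu}\bigl|(1-\delta)I_{n_d}-\delta\Theta\bigr|^{-L}\Bigr],$$ $$\qquad\min_{0\le\eta\le\nu}\Bigl\{2-\frac{\gamma(n_dL,n_dL\eta)}{\Gamma(n_dL)}-\mathbb E_{A,B}\Bigl[\frac{\gamma\bigl(Ln^*,\frac{n_dL(\nu-\eta)}{\lambda_{\max}(\Theta)}\bigr)}{\Gamma(Ln^*)}\Bigr]\Bigr\}\Bigr\},$$ $$D=(1+r)I_{2n_d}+u(1-u+r)\bar\Sigma_1+r\bar\Sigma_2-u(u-r)\bar\Sigma_1\bar\Sigma_2,\qquad n^*=\min\{K,n_d\},$$ $$\hat\Sigma=I_K-(I_K+B^HB)^{-1},\qquad\tilde\Sigma=(I_K+B^HB)^{-1},\qquad \Theta=\tilde A_{\mathcal K}\tilde\Sigma\tilde A_{\mathcal K}^H.$$ The matrices $\bar\Sigma_1,\bar\Sigma_2$ are the real $2n_d\times2n_d$ forms $\begin{bmatrix}\Re X&-\Im X\\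 \Im X&\Re X\end{bmatrix}$ of $X=(\tilde A_{S_1}-\tilde A'_{S_1})\hat\Sigma(\tilde A_{S_1}-\tilde A'_{S_1})^H$ and of $X=\Theta$, respectively. The set $S_1\subset[K]$ is any subset of size $t$, and $w,w'\in[M]^K$ are any message vectors with $w_k\ne w'_k$ for all $k$. The $n_d\times K$ matrices $\tilde A_{\mathcal K}$, $\tilde A_{S_1}$, $\tilde A'_{S_1}$ are obtained from $A$ by selection matrices: column $k$ of $\tilde A_{\mathcal K}$ is $c_{k,w_k}$; column $k$ of $\tilde A_{S_1}$ is $c_{k,w_k}$ and column $k$ of $\tilde A'_{S_1}$ is $c_{k,w'_k}$ for $k\in S_1$, and both are $0$ for $k\notin S_1$. The expectations are over $A$ and $B$, distributed as above; $|\cdot|$ is the determinant; $\gamma$ is the lower incomplete gamma function, with $\gamma(\cdot,x)=0$ for $x\le0$; $\lambda_{\max}$ is the largest eigenvalue. Since $D$ need not be symmetric, $\lambda_{\min}(D)>0$ means that every complex eigenvalue of $D$ has positive real part. Moreover, for any pilots that are orthogonal with $n_p=K$ and $\|b_k\|_2^2=n_pP_p$, one has $\hat\Sigma=\frac{n_pP_p}{1+n_pP_p}I_K$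 and $\tilde\Sigma=\frac1{1+n_pP_p}I_K$. -/

import Mathlib

open MeasureTheory ProbabilityTheory
open scoped ENNReal NNReal Matrix

noncomputable section

namespace PilotAccess

/-- The circularly symmetric complex Gaussian law `CN(0, v)`: independent real and imaginary
parts, each `N(0, v / 2)`. -/
def complexGaussian (v : ℝ≥0) : Measure ℂ :=
  ((gaussianReal 0 (v / 2)).prod (gaussianReal 0 (v / 2))).map
    (fun p : ℝ × ℝ => (⟨p.1, p.2⟩ : ℂ))

/-- The law of an array with i.i.d. `CN(0, v)` entries. -/
def gaussianArray (ι κ : Type) [Fintype ι] [Fintype κ] (v : ℝ≥0) : Measure (ι → κ → ℂ) :=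
  Measure.pi fun _ => Measure.pi fun _ => complexGaussian v

/-- The uniform law on the sphere of radius `ρ` in `ℂ^m`: the normalised surface measure of the
unit sphere, pushed forward by `x ↦ ρ x`. -/
def sphereLaw (m : ℕ) (ρ : ℝ) : Measure (EuclideanSpace ℂ (Fin m)) :=
  Measure.map
    (fun x : Metric.sphere (0 : EuclideanSpace ℂ (Fin m)) 1 => ρ • (x : EuclideanSpace ℂ (Fin m)))
    (((volume : Measure (EuclideanSpace ℂ (Fin m))).toSphere Set.univ)⁻¹ •
      (volume : Measure (EuclideanSpace ℂ (Fin m))).toSphere)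

/-- The lower incomplete gamma function `γ(s, x)`, which is `0` for `x ≤ 0`. -/
def lowerGamma (s x : ℝ) : ℝ :=
  ∫ t in Set.Ioc 0 x, t ^ (s - 1) * Real.exp (-t)

/-! ### The pilot-assisted scheme -/

/-- The pilots of all users. -/
abbrev Pilots (np K : ℕ) : Type := Fin K → EuclideanSpace ℂ (Fin np)

/-- The Gaussian codebooks of all users; the entry `(i, (k, m))` is the `i`-th symbol of the `m`-th
codeword of user `k`. -/
abbrev Codebooks (nd K M : ℕ) : Type := Fin nd → Fin K × Fin M → ℂ

/-- Independent pilots, uniform on the sphere of radius `√(n_p P_p)`. -/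
def pilotLaw (np K : ℕ) (Pp : ℝ) : Measure (Pilots np K) :=
  Measure.pi fun _ => sphereLaw np (Real.sqrt (np * Pp))

/-- Codebooks with i.i.d. `CN(0, P')` entries. -/
def codebookLaw (nd K M : ℕ) (P' : ℝ) : Measure (Codebooks nd K M) :=
  gaussianArray (Fin nd) (Fin K × Fin M) P'.toNNReal

/-- Independent messages, uniform on `Fin M`. -/
def messageLaw (K M : ℕ) : Measure (Fin K → Fin M) :=
  Measure.pi fun _ => uniformOn Set.univ

/-- The pilot matrix `B`, whose columns are the pilots. -/
def pilotMatrix {np K : ℕ} (b : Pilots np K) : Matrix (Fin np) (Fin K) ℂ :=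
  Matrix.of fun i k => b k i

/-- The concatenated codebook matrix `A`. -/
def codebookMatrix {nd K M : ℕ} (a : Codebooks nd K M) : Matrix (Fin nd) (Fin K × Fin M) ℂ :=
  Matrix.of a

/-- The binary selection matrix that selects, for every user `k ∈ S`, its codeword `w k`. -/
def selection {K M : ℕ} (S : Finset (Fin K)) (w : Fin K → Fin M) :
    Matrix (Fin K × Fin M) (Fin K) ℂ :=
  Matrix.of fun km k => if k ∈ S ∧ km = (k, w k) then 1 else 0

/-- The `n_d × K` matrix whose column `k` is the codeword `w k` of user `k` if `k ∈ S`, and zero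
otherwise. -/
def selected {nd K M : ℕ} (a : Codebooks nd K M) (S : Finset (Fin K)) (w : Fin K → Fin M) :
    Matrix (Fin nd) (Fin K) ℂ :=
  codebookMatrix a * selection S w

/-- The matrix of transmitted codewords: a selected codeword whose energy exceeds `E` is replaced
by zero. -/
def transmitted {nd K M : ℕ} (E : ℝ) (a : Codebooks nd K M) (w : Fin K → Fin M) :
    Matrix (Fin nd) (Fin K) ℂ :=
  Matrix.of fun i k => if ∑ j, ‖a j (k, w k)‖ ^ 2 ≤ E then a i (k, w k) else 0

/-- The squared Frobenius norm. -/
def frobSq {m n : ℕ} (X : Matrix (Fin m) (Fin n) ℂ) : ℝ := ∑ i, ∑ j, ‖X i j‖ ^ 2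

/-- The MMSE channel estimate `(I + Bᴴ B)⁻¹ Bᴴ Y_p`. -/
def channelEstimate {np K L : ℕ} (B : Matrix (Fin np) (Fin K) ℂ) (Yp : Matrix (Fin np) (Fin L) ℂ) :
    Matrix (Fin K) (Fin L) ℂ :=
  (1 + Bᴴ * B)⁻¹ * Bᴴ * Yp

/-- What the receiver knows: pilots, codebooks, and the signals received in the pilot phase and in
the data phase. -/
abbrev Observation (np nd K M L : ℕ) : Type :=
  Pilots np K × Codebooks nd K M × (Fin np → Fin L → ℂ) × (Fin nd → Fin L → ℂ)

/-- The decoding metric `‖Y_d - Â Ĥ‖_F²` of the candidate messages `w`; the channel estimate is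
used as if it were the true channel. -/
def metric {np nd K M L : ℕ} (o : Observation np nd K M L) (w : Fin K → Fin M) : ℝ :=
  frobSq (Matrix.of o.2.2.2 -
    selected o.2.1 Finset.univ w * channelEstimate (pilotMatrix o.1) (Matrix.of o.2.2.1))

/-- A mismatched nearest-neighbour decoder: a measurable rule that always outputs a minimiser of
the metric, with ties broken in any way. -/
def IsNearestNeighbour {np nd K M L : ℕ} (dec : Observation np nd K M L → Fin K → Fin M) : Prop :=
  Measurable dec ∧ ∀ o w, metric o (dec o) ≤ metric o w

/-- The random objects of the scheme: pilots, codebooks, messages, the fading matrix `H`, and the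
noise matrices of the pilot phase and of the data phase. -/
abbrev Sample (np nd K M L : ℕ) : Type :=
  Pilots np K × Codebooks nd K M × (Fin K → Fin M) × (Fin K → Fin L → ℂ) ×
    (Fin np → Fin L → ℂ) × (Fin nd → Fin L → ℂ)

/-- All these objects are independent; fading and noise have i.i.d. `CN(0, 1)` entries. -/
def schemeLaw (np nd K M L : ℕ) (Pp P' : ℝ) : Measure (Sample np nd K M L) :=
  (pilotLaw np K Pp).prod <| (codebookLaw nd K M P').prod <| (messageLaw K M).prod <|
    (gaussianArray (Fin K) (Fin L) 1).prod <|
      (gaussianArray (Fin np) (Fin L) 1).prod (gaussianArray (Fin nd) (Fin L) 1)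

/-- The observation: `Y_p = B H + Z_p` and `Y_d = X H + Z_d`, where `X` holds the transmitted
codewords. -/
def observe {np nd K M L : ℕ} (E : ℝ) : Sample np nd K M L → Observation np nd K M L
  | (b, a, w, H, Zp, Zd) =>
    (b, a, pilotMatrix b * (Matrix.of H : Matrix (Fin K) (Fin L) ℂ) + Matrix.of Zp,
      transmitted E a w * (Matrix.of H : Matrix (Fin K) (Fin L) ℂ) + Matrix.of Zd)

/-- The per-user probability of error `(1 / K) ∑ₖ ℙ[Wₖ ≠ Ŵₖ]` of the scheme with pilot power `Pp`,
codebook variance `P'`, codeword energy limit `E` and decoder `dec`. -/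
def pupe {np nd K M L : ℕ} (Pp P' E : ℝ) (dec : Observation np nd K M L → Fin K → Fin M) : ℝ≥0∞ :=
  (K : ℝ≥0∞)⁻¹ * ∑ k : Fin K, schemeLaw np nd K M L Pp P'
    {ω | ω.2.2.1 k ≠ dec (observe E ω) k}

/-! ### The quantities in the bound -/

/-- `Σ̃ = (I + Bᴴ B)⁻¹`. -/
def sigmaTilde {np K : ℕ} (B : Matrix (Fin np) (Fin K) ℂ) : Matrix (Fin K) (Fin K) ℂ :=
  (1 + Bᴴ * B)⁻¹

/-- `Σ̂ = I - (I + Bᴴ B)⁻¹`. -/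
def sigmaHat {np K : ℕ} (B : Matrix (Fin np) (Fin K) ℂ) : Matrix (Fin K) (Fin K) ℂ :=
  1 - (1 + Bᴴ * B)⁻¹

/-- The real `2n × 2n` matrix `[[Re X, -Im X], [Im X, Re X]]`. -/
def realify {n : ℕ} (X : Matrix (Fin n) (Fin n) ℂ) : Matrix (Fin n ⊕ Fin n) (Fin n ⊕ Fin n) ℝ :=
  Matrix.fromBlocks (X.map Complex.re) (-(X.map Complex.im)) (X.map Complex.im) (X.map Complex.re)

/-- The largest (real) eigenvalue; it is only used for Hermitian matrices. -/
def lambdaMax {n : ℕ} (X : Matrix (Fin n) (Fin n) ℂ) : ℝ := sSup (spectrum ℝ X)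

/-- `Ã_𝒦 Σ̃ Ã_𝒦ᴴ`. -/
def errorCov {np nd K M : ℕ} (b : Pilots np K) (a : Codebooks nd K M) (w : Fin K → Fin M) :
    Matrix (Fin nd) (Fin nd) ℂ :=
  selected a Finset.univ w * sigmaTilde (pilotMatrix b) * (selected a Finset.univ w)ᴴ

/-- `(Ã_S - Ã'_S) Σ̂ (Ã_S - Ã'_S)ᴴ`. -/
def confusionCov {np nd K M : ℕ} (b : Pilots np K) (a : Codebooks nd K M) (S : Finset (Fin K))
    (w w' : Fin K → Fin M) : Matrix (Fin nd) (Fin nd) ℂ :=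
  (selected a S w - selected a S w') * sigmaHat (pilotMatrix b) *
    (selected a S w - selected a S w')ᴴ

/-- `D = (1 + r) I + u (1 - u + r) Σ₁ + r Σ₂ - u (u - r) Σ₁ Σ₂`. -/
def matrixD {np nd K M : ℕ} (b : Pilots np K) (a : Codebooks nd K M) (S : Finset (Fin K))
    (w w' : Fin K → Fin M) (u r : ℝ) : Matrix (Fin nd ⊕ Fin nd) (Fin nd ⊕ Fin nd) ℝ :=
  (1 + r) • (1 : Matrix (Fin nd ⊕ Fin nd) (Fin nd ⊕ Fin nd) ℝ)
    + (u * (1 - u + r)) • realify (confusionCov b a S w w')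
    + r • realify (errorCov b a w)
    - (u * (u - r)) • (realify (confusionCov b a S w w') * realify (errorCov b a w))

/-- The condition `λ_min(D) > 0` for a real square matrix that need not be symmetric: every complex
eigenvalue has positive real part. -/
def EigenvaluesPos {ι : Type} [Fintype ι] [DecidableEq ι] (D : Matrix ι ι ℝ) : Prop :=
  ∀ z ∈ spectrum ℂ (D.map (fun x : ℝ => (x : ℂ))), 0 < z.re

/-- `p₀ = K (1 - γ(n_d, E / P') / Γ(n_d))`. -/
def p0 (nd K : ℕ) (P' E : ℝ) : ℝ :=
  K * (1 - lowerGamma nd (E / P') / Real.Gamma nd)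

/-- The term `q_{1,t}(ν)`. -/
def q1 {nd K M : ℕ} (np L : ℕ) (Pp P' : ℝ) (t : ℕ) (S : Finset (Fin K)) (w w' : Fin K → Fin M)
    (ν : ℝ) : ℝ≥0∞ :=
  (K.choose t : ℝ≥0∞) * (M : ℝ≥0∞) ^ t *
    ∫⁻ x : Pilots np K × Codebooks nd K M,
      ⨅ (u : ℝ) (r : ℝ) (_ : 0 ≤ u) (_ : 0 ≤ r) (_ : EigenvaluesPos (matrixD x.1 x.2 S w w' u r)),
        ENNReal.ofReal (Real.exp
          (r * nd * L * ν - (L : ℝ) / 2 * Real.log (matrixD x.1 x.2 S w w' u r).det))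
      ∂((pilotLaw np K Pp).prod (codebookLaw nd K M P'))

/-- The first of the two terms in the minimum that defines `q_{2,t}(ν)`. -/
def q2Chernoff {nd K M : ℕ} (np L : ℕ) (Pp P' : ℝ) (w : Fin K → Fin M) (ν : ℝ) : ℝ≥0∞ :=
  ∫⁻ x : Pilots np K × Codebooks nd K M,
    ⨅ (δ : ℝ) (_ : 0 ≤ δ) (_ : δ < 1 / (1 + lambdaMax (errorCov x.1 x.2 w))),
      ENNReal.ofReal (Real.exp (-(δ * nd * L * ν)) *
        ((((1 - (δ : ℂ)) • (1 : Matrix (Fin nd) (Fin nd) ℂ)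
          - (δ : ℂ) • errorCov x.1 x.2 w).det).re ^ L)⁻¹)
    ∂((pilotLaw np K Pp).prod (codebookLaw nd K M P'))

/-- The second of the two terms in the minimum that defines `q_{2,t}(ν)`. -/
def q2Gamma {nd K M : ℕ} (np L : ℕ) (Pp P' : ℝ) (w : Fin K → Fin M) (ν : ℝ) : ℝ≥0∞ :=
  ⨅ (η : ℝ) (_ : 0 ≤ η) (_ : η ≤ ν),
    ENNReal.ofReal (2 - lowerGamma (nd * L) (nd * L * η) / Real.Gamma (nd * L)
      - ∫ x : Pilots np K × Codebooks nd K M,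
          lowerGamma (L * (min K nd : ℕ))
              (nd * L * (ν - η) / lambdaMax (errorCov x.1 x.2 w)) /
            Real.Gamma (L * (min K nd : ℕ))
        ∂((pilotLaw np K Pp).prod (codebookLaw nd K M P')))

/-- The term `q_{2,t}(ν)`. -/
def q2 {nd K M : ℕ} (np L : ℕ) (Pp P' : ℝ) (w : Fin K → Fin M) (ν : ℝ) : ℝ≥0∞ :=
  min (q2Chernoff (nd := nd) np L Pp P' w ν) (q2Gamma (nd := nd) np L Pp P' w ν)

/-- `p_t = min_{ν ≥ 0} {q_{1,t}(ν) + q_{2,t}(ν)}`. -/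
def pt {K M : ℕ} (np nd L : ℕ) (Pp P' : ℝ) (t : ℕ) (S : Finset (Fin K)) (w w' : Fin K → Fin M) :
    ℝ≥0∞ :=
  ⨅ (ν : ℝ) (_ : 0 ≤ ν),
    q1 (nd := nd) np L Pp P' t S w w' ν + q2 (nd := nd) np L Pp P' w ν

/-- `p₀ + ∑_{t=1}^{K} (t / K) min{1, p_t}`, where `S t` is the `t`-subset of users used in `p_t`. -/
def pupeBound {K M : ℕ} (np nd L : ℕ) (Pp P' E : ℝ) (S : ℕ → Finset (Fin K))
    (w w' : Fin K → Fin M) : ℝ≥0∞ :=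
  ENNReal.ofReal (p0 nd K P' E) +
    ∑ t ∈ Finset.Icc 1 K, ((t : ℝ≥0∞) / (K : ℝ≥0∞)) * min 1 (pt np nd L Pp P' t (S t) w w')

end PilotAccess

end

/-!
The bound is a union bound, followed by exact Gaussian computations given the pilots and the
codebooks.

*Truncation.* Unless some codeword is replaced by zero, the observation is
`Y_p = B H + Z_p`, `Y_d = A_w H + Z_d`, where `A_w` holds the selected codewords. The exceptional
event has probability at most `p₀`, since the energy of a codeword is a scaled Gamma variable
(`codebookLaw_energy_gt`). On the complement, the wrongly decoded users are counted according to
their number `t` (`sum_schemeLaw_userError`).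

*The Gaussian pair.* Write `Ĥ` for the channel estimate. When `w` is sent, the metric of `w` is the
energy of the residual `g = A_w (H - Ĥ) + Z_d`, and the metric of `v` is the energy of `g + e`, where
`e = (A_w - A_v) Ĥ`. The columns of `(g, e)` are linear images of a standard Gaussian array, and the
orthogonality of the MMSE estimate and its error gives the covariance `diag(I + Θ, X)`
(`covariance_residual_confusion`), where `X` is the confusion covariance. The law of a linear image
depends on its covariance only (`map_linImage_eq`), by characteristic functions.

*Confusion.* If `v` is preferred to `w` and `|g|² ≤ n_d L ν`, then
`r n_d L ν - r |g|² - u (|g + e|² - |g|²) ≥ 0` for `u, r ≥ 0`. Chernoff's bound leads to the Gaussian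
integral of a Hermitian form, which equals `det(I + R)^{-L}` if `I + R` is positive definite
(`lintegral_exp_neg_quadraticForm`). Block elimination reduces this determinant to that of a complex
`n_d × n_d` matrix (`det_one_add_chernoffForm`), whose real form is `D` (`matrixD_eq_realify`), so
that `det D` is the square of `det(I + R)` (`det_realify`). This is the factor `L / 2` in the
exponent.

The remaining point is that the eigenvalue condition on `D`, which is not symmetric, implies that
`I + R` is positive definite (`posDef_one_add_chernoffForm`). For `r ≥ u` the form is nonnegative.
For `r < u` the covariance is deformed along a segment to a block diagonal one with scalar blocks,
chosen such that along the segment `D` is the combination `a (1 - t²) I + t² D` of the identity and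
its final value. This is invertible, because `D` has no eigenvalue in `(-∞, 0]`; and a path of
invertible Hermitian matrices that starts at a positive one stays positive (`posDef_of_path`).

*Large residual.* The energy of `g` is a combination of independent Gamma variables with weights
`1 + λ_i(Θ)` (`gaussianArray_energy_linImage`). Chernoff's bound gives one tail estimate. For the
other, the part with weights `λ_i(Θ)` has at most `min(K, n_d)` nonzero terms, because of the rank of
`Θ`, and is at most `λ_max(Θ)` times a Gamma variable.

*Averaging.* Renaming users and messages preserves the law of pilots and codebooks, and acts
transitively on pairs of message vectors that differ exactly on `t` users (`exists_relabel`).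
Hence all the terms of the union bound, over at most `binom(K, t) M^t` wrong message vectors, have the
same bound, and it may be evaluated at any fixed `S`, `w`, `w'`.
-/

namespace PilotAccess

/-! ### Gaussian arrays: the law of a linear image -/

section GaussianArrays

set_option linter.unusedSectionVars false

variable {ι ι' κ m : Type} [Fintype ι] [Fintype ι'] [Fintype κ] [Fintype m]

lemma complexGaussian_eq_map (v : ℝ≥0) :
    complexGaussian v = ((gaussianReal 0 (v / 2)).prod (gaussianReal 0 (v / 2))).map
      Complex.measurableEquivRealProd.symm := rfl

instance isProbabilityMeasure_complexGaussian (v : ℝ≥0) :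
    IsProbabilityMeasure (complexGaussian v) := by
  rw [complexGaussian_eq_map]
  exact Measure.isProbabilityMeasure_map Complex.measurableEquivRealProd.symm.measurable.aemeasurable

instance isProbabilityMeasure_gaussianArray (v : ℝ≥0) :
    IsProbabilityMeasure (gaussianArray ι κ v) := by
  unfold gaussianArray; infer_instance

/-- The real inner product `∑ Re (conj T * Z)` of two complex arrays. -/
noncomputable def pairing (T Z : ι → κ → ℂ) : ℝ := ∑ i, ∑ k, ((starRingEnd ℂ) (T i k) * Z i k).re

/-- The squared Frobenius norm of an array over arbitrary index types. -/
noncomputable def energy (Z : ι → κ → ℂ) : ℝ := ∑ i, ∑ k, ‖Z i k‖ ^ 2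

/-- The array `P Z`. -/
noncomputable def linImage (P : Matrix m ι ℂ) (Z : ι → κ → ℂ) : m → κ → ℂ :=
  fun i k => ∑ j, P i j * Z j k

lemma pairing_self (Z : ι → κ → ℂ) : pairing Z Z = energy Z := by
  unfold pairing energy
  refine Finset.sum_congr rfl fun i _ => Finset.sum_congr rfl fun k _ => ?_
  rw [← Complex.normSq_eq_conj_mul_self, Complex.ofReal_re, Complex.normSq_eq_norm_sq]

lemma linImage_linImage {m' : Type} [Fintype m'] (P : Matrix m' m ℂ) (Q : Matrix m ι ℂ)
    (Z : ι → κ → ℂ) : linImage P (linImage Q Z) = linImage (P * Q) Z := by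
  have := Matrix.mul_assoc P Q (Matrix.of Z)
  funext i k
  exact (congrFun (congrFun this i) k).symm

lemma linImage_one [DecidableEq ι] (Z : ι → κ → ℂ) : linImage (1 : Matrix ι ι ℂ) Z = Z := by
  have := Matrix.one_mul (Matrix.of Z)
  funext i k
  exact congrFun (congrFun this i) k

lemma pairing_linImage (P : Matrix m ι ℂ) (T : m → κ → ℂ) (Z : ι → κ → ℂ) :
    pairing T (linImage P Z) = pairing (linImage Pᴴ T) Z := by
  simp only [pairing, linImage, Finset.mul_sum, map_sum, Finset.sum_mul, Complex.re_sum,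
    Matrix.conjTranspose_apply, map_mul]
  calc _ = ∑ i, ∑ j, ∑ k, ((starRingEnd ℂ) (T i k) * (P i j * Z j k)).re :=
        Finset.sum_congr rfl fun i _ => Finset.sum_comm
    _ = ∑ j, ∑ i, ∑ k, ((starRingEnd ℂ) (T i k) * (P i j * Z j k)).re := Finset.sum_comm
    _ = ∑ j, ∑ k, ∑ i, ((starRingEnd ℂ) (T i k) * (P i j * Z j k)).re :=
        Finset.sum_congr rfl fun i _ => Finset.sum_comm
    _ = _ := by
        refine Finset.sum_congr rfl fun i _ => Finset.sum_congr rfl fun k _ =>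
          Finset.sum_congr rfl fun j _ => ?_
        congr 1
        simp only [RCLike.star_def, Complex.conj_conj]
        ring

lemma continuous_linImage (P : Matrix m ι ℂ) :
    Continuous (linImage P : (ι → κ → ℂ) → m → κ → ℂ) := by
  unfold linImage; fun_prop

lemma measurable_linImage (P : Matrix m ι ℂ) :
    Measurable (linImage P : (ι → κ → ℂ) → m → κ → ℂ) :=
  (continuous_linImage P).measurable

lemma continuous_energy : Continuous (energy : (ι → κ → ℂ) → ℝ) := by
  unfold energy; fun_prop

/-- Every real-linear functional on complex arrays is a pairing. -/
lemma exists_pairing_eq (f : StrongDual ℝ (ι → κ → ℂ)) :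
    ∃ T : ι → κ → ℂ, ∀ Z, f Z = pairing T Z := by
  classical
  refine ⟨fun i k => ⟨f (Pi.single i (Pi.single k 1)), f (Pi.single i (Pi.single k Complex.I))⟩,
    fun Z => ?_⟩
  have hZ : Z = ∑ i, ∑ k, ((Z i k).re • (Pi.single i (Pi.single k (1 : ℂ)) : ι → κ → ℂ) +
      (Z i k).im • (Pi.single i (Pi.single k Complex.I) : ι → κ → ℂ)) := by
    funext i k
    simp only [Finset.sum_apply, Pi.add_apply, Pi.smul_apply]
    rw [Finset.sum_eq_single i, Finset.sum_eq_single k]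
    · simp only [Pi.single_eq_same]
      apply Complex.ext <;> simp
    · intro b _ hb; simp [Pi.single_eq_of_ne hb.symm]
    · simp
    · intro b _ hb; simp [Pi.single_eq_of_ne hb.symm]
    · simp
  conv_lhs => rw [hZ]
  simp only [map_sum, map_add, map_smul, pairing, smul_eq_mul]
  refine Finset.sum_congr rfl fun i _ => Finset.sum_congr rfl fun k _ => ?_
  simp [Complex.mul_re]; ring

lemma integral_exp_complexGaussian (t : ℂ) :
    ∫ z, Complex.exp ((((starRingEnd ℂ) t * z).re : ℝ) * Complex.I) ∂(complexGaussian 1) =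
      Complex.exp (-((‖t‖ ^ 2 : ℝ) : ℂ) / 4) := by
  rw [complexGaussian_eq_map, integral_map_equiv]
  have h : ∀ p : ℝ × ℝ, Complex.exp ((((starRingEnd ℂ) t *
      Complex.measurableEquivRealProd.symm p).re : ℝ) * Complex.I) =
      Complex.exp (t.re * p.1 * Complex.I) * Complex.exp (t.im * p.2 * Complex.I) := by
    intro p
    rw [← Complex.exp_add]
    congr 1
    rw [Complex.measurableEquivRealProd_symm_apply]
    simp [Complex.mul_re]; ring
  simp_rw [h]
  rw [integral_prod_mul (fun x : ℝ => Complex.exp (t.re * x * Complex.I))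
    (fun x : ℝ => Complex.exp (t.im * x * Complex.I)), ← charFun_apply_real, ← charFun_apply_real,
    charFun_gaussianReal, charFun_gaussianReal, ← Complex.exp_add]
  congr 1
  rw [Complex.sq_norm, Complex.normSq_apply]
  push_cast
  ring

lemma integral_exp_gaussianArray (T : ι → κ → ℂ) :
    ∫ Z, Complex.exp ((pairing T Z : ℝ) * Complex.I) ∂(gaussianArray ι κ 1) =
      Complex.exp (-((energy T : ℝ) : ℂ) / 4) := by
  have h : ∀ Z : ι → κ → ℂ, Complex.exp ((pairing T Z : ℝ) * Complex.I) =
      ∏ i, ∏ k, Complex.exp ((((starRingEnd ℂ) (T i k) * Z i k).re : ℝ) * Complex.I) := by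
    intro Z
    simp_rw [← Complex.exp_sum, pairing, ← Finset.sum_mul]
    push_cast
    rfl
  simp_rw [h, gaussianArray]
  rw [integral_fintype_prod_eq_prod (fun i (z : κ → ℂ) =>
    ∏ k, Complex.exp ((((starRingEnd ℂ) (T i k) * z k).re : ℝ) * Complex.I))]
  have h2 : ∀ i, ∫ z : κ → ℂ, (∏ k, Complex.exp ((((starRingEnd ℂ) (T i k) * z k).re : ℝ) *
      Complex.I)) ∂(Measure.pi fun _ => complexGaussian 1) =
      ∏ k, Complex.exp (-((‖T i k‖ ^ 2 : ℝ) : ℂ) / 4) := by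
    intro i
    rw [integral_fintype_prod_eq_prod (fun k (z : ℂ) =>
      Complex.exp ((((starRingEnd ℂ) (T i k) * z).re : ℝ) * Complex.I))]
    simp_rw [integral_exp_complexGaussian]
  simp_rw [h2, ← Complex.exp_sum, energy]
  congr 1
  push_cast
  simp_rw [← Finset.sum_div, Finset.sum_neg_distrib]

/-- The law of a linear image `P Z` of a standard Gaussian array depends only on `P Pᴴ`. -/
theorem map_linImage_eq (P : Matrix m ι ℂ) (Q : Matrix m ι' ℂ) (h : P * Pᴴ = Q * Qᴴ) :
    (gaussianArray ι κ 1).map (linImage P) = (gaussianArray ι' κ 1).map (linImage Q) := by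
  have key : ∀ {ι₀ : Type} [Fintype ι₀] (R : Matrix m ι₀ ℂ) (T : m → κ → ℂ),
      ∫ Z, Complex.exp ((pairing T Z : ℝ) * Complex.I) ∂((gaussianArray ι₀ κ 1).map (linImage R)) =
        Complex.exp (-((pairing T (linImage (R * Rᴴ) T) : ℝ) : ℂ) / 4) := by
    intro ι₀ _ R T
    rw [integral_map (measurable_linImage R).aemeasurable]
    · simp_rw [pairing_linImage R T]
      rw [integral_exp_gaussianArray, ← pairing_self, ← pairing_linImage, linImage_linImage]
    · apply Continuous.aestronglyMeasurable
      unfold pairing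
      fun_prop
  have : IsProbabilityMeasure ((gaussianArray ι κ 1).map (linImage P)) :=
    Measure.isProbabilityMeasure_map (measurable_linImage P).aemeasurable
  have : IsProbabilityMeasure ((gaussianArray ι' κ 1).map (linImage Q)) :=
    Measure.isProbabilityMeasure_map (measurable_linImage Q).aemeasurable
  refine Measure.ext_of_charFunDual (funext fun f => ?_)
  obtain ⟨T, hT⟩ := exists_pairing_eq f
  simp_rw [charFunDual_apply, hT, key, h]

end GaussianArrays

/-! ### Gaussian integrals of quadratic forms -/

section QuadraticForms

open scoped ComplexOrder

variable {ι κ m : Type} [Fintype ι] [Fintype κ] [Fintype m]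

lemma integral_exp_sq_gaussianReal {c : ℂ} (hc : 0 < (1 + c).re) :
    ∫ x : ℝ, Complex.exp (-(c * (x : ℂ) ^ 2)) ∂(gaussianReal 0 (1 / 2)) =
      (1 / (1 + c)) ^ (1 / 2 : ℂ) := by
  have hne : (1 + c) ≠ 0 := fun h => by rw [h] at hc; simp at hc
  rw [integral_gaussianReal_eq_integral_smul (by norm_num)]
  have h : ∀ x : ℝ, gaussianPDFReal 0 (1 / 2) x • Complex.exp (-(c * (x : ℂ) ^ 2)) =
      (((√Real.pi)⁻¹ : ℝ) : ℂ) * Complex.exp (-(1 + c) * (x : ℂ) ^ 2) := by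
    intro x
    rw [gaussianPDFReal, Complex.real_smul]
    push_cast
    rw [mul_assoc, ← Complex.exp_add]
    congr 2
    · congr 2; ring
    · ring
  simp_rw [h]
  rw [integral_const_mul, integral_gaussian_complex hc]
  have hpi : (((√Real.pi)⁻¹ : ℝ) : ℂ) = Complex.exp (-(Real.log Real.pi / 2 : ℝ)) := by
    rw [Real.sqrt_eq_rpow, Real.rpow_def_of_pos Real.pi_pos, ← Real.exp_neg]
    push_cast
    congr 1
    ring
  rw [hpi, div_eq_mul_inv (Real.pi : ℂ), one_div (1 + c), Complex.cpow_def_of_ne_zero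
    (mul_ne_zero (by simp [Real.pi_ne_zero]) (inv_ne_zero hne)),
    Complex.cpow_def_of_ne_zero (inv_ne_zero hne), Complex.log_ofReal_mul Real.pi_pos
    (inv_ne_zero hne), ← Complex.exp_add]
  congr 1
  push_cast
  ring

lemma integral_exp_sq_complexGaussian {c : ℂ} (hc : 0 < (1 + c).re) :
    ∫ z : ℂ, Complex.exp (-(c * ((‖z‖ ^ 2 : ℝ) : ℂ))) ∂(complexGaussian 1) = (1 + c)⁻¹ := by
  have hne : (1 + c) ≠ 0 := fun h => by rw [h] at hc; simp at hc
  rw [complexGaussian_eq_map, integral_map_equiv]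
  have h : ∀ p : ℝ × ℝ, Complex.exp (-(c * ((‖Complex.measurableEquivRealProd.symm p‖ ^ 2 : ℝ)))) =
      Complex.exp (-(c * (p.1 : ℂ) ^ 2)) * Complex.exp (-(c * (p.2 : ℂ) ^ 2)) := by
    intro p
    rw [← Complex.exp_add, Complex.measurableEquivRealProd_symm_apply, Complex.sq_norm,
      Complex.normSq_apply]
    congr 1
    push_cast
    ring
  simp_rw [h]
  rw [integral_prod_mul (fun x : ℝ => Complex.exp (-(c * (x : ℂ) ^ 2)))
    (fun x : ℝ => Complex.exp (-(c * (x : ℂ) ^ 2))), integral_exp_sq_gaussianReal hc,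
    ← Complex.cpow_add _ _ (by simpa using hne)]
  norm_num

/-- The Laplace transform, at complex arguments, of the weighted row energies of a standard
Gaussian array. -/
lemma integral_exp_weighted_energy (c : ι → ℂ) (hc : ∀ i, 0 < (1 + c i).re) :
    ∫ Z, Complex.exp (-∑ i, c i * ((∑ k, ‖Z i k‖ ^ 2 : ℝ) : ℂ)) ∂(gaussianArray ι κ 1) =
      ∏ i, (1 + c i)⁻¹ ^ Fintype.card κ := by
  have h : ∀ Z : ι → κ → ℂ, Complex.exp (-∑ i, c i * ((∑ k, ‖Z i k‖ ^ 2 : ℝ) : ℂ)) =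
      ∏ i, ∏ k, Complex.exp (-(c i * ((‖Z i k‖ ^ 2 : ℝ) : ℂ))) := by
    intro Z
    simp_rw [← Complex.exp_sum, Finset.sum_neg_distrib, ← Finset.mul_sum]
    push_cast
    rfl
  simp_rw [h, gaussianArray]
  rw [integral_fintype_prod_eq_prod (fun i (z : κ → ℂ) =>
    ∏ k, Complex.exp (-(c i * ((‖z k‖ ^ 2 : ℝ) : ℂ))))]
  refine Finset.prod_congr rfl fun i _ => ?_
  rw [integral_fintype_prod_eq_prod (fun (_ : κ) (z : ℂ) =>
      Complex.exp (-(c i * ((‖z‖ ^ 2 : ℝ) : ℂ))))]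
  simp_rw [integral_exp_sq_complexGaussian (hc i)]
  simp

lemma lintegral_exp_weighted_energy (c : ι → ℝ) (hc : ∀ i, 0 < 1 + c i) :
    ∫⁻ Z, ENNReal.ofReal (Real.exp (-∑ i, c i * ∑ k, ‖Z i k‖ ^ 2)) ∂(gaussianArray ι κ 1) =
      ENNReal.ofReal ((∏ i, (1 + c i))⁻¹ ^ Fintype.card κ) := by
  have h := integral_exp_weighted_energy (κ := κ) (fun i => (c i : ℂ)) (fun i => by simpa using hc i)
  have h2 : ∫ Z, Real.exp (-∑ i, c i * ∑ k, ‖Z i k‖ ^ 2) ∂(gaussianArray ι κ 1) =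
      (∏ i, (1 + c i))⁻¹ ^ Fintype.card κ := by
    apply Complex.ofReal_injective
    rw [← integral_complex_ofReal]
    rw [Finset.prod_pow, Finset.prod_inv_distrib] at h
    push_cast at h ⊢
    exact h
  have hpos : 0 < (∏ i, (1 + c i))⁻¹ ^ Fintype.card κ :=
    pow_pos (inv_pos.2 (Finset.prod_pos fun i _ => hc i)) _
  rw [← h2, ofReal_integral_eq_lintegral_ofReal]
  · -- The integral is nonzero, so the integrand is integrable.
    by_contra hcon
    rw [integral_undef hcon] at h2
    exact hpos.ne h2
  · exact Filter.Eventually.of_forall fun Z => (Real.exp_pos _).le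

/-- Diagonalisation of a Hermitian matrix by a unitary matrix. -/
lemma exists_unitary_diagonal [DecidableEq ι] {R : Matrix ι ι ℂ} (hR : R.IsHermitian) :
    ∃ U : Matrix ι ι ℂ, Uᴴ * U = 1 ∧ U * Uᴴ = 1 ∧
      R = U * Matrix.diagonal (fun i => (hR.eigenvalues i : ℂ)) * Uᴴ := by
  refine ⟨hR.eigenvectorUnitary, ?_, ?_, ?_⟩
  · exact Unitary.coe_star_mul_self hR.eigenvectorUnitary
  · exact Unitary.coe_mul_star_self hR.eigenvectorUnitary
  · conv_lhs => rw [hR.spectral_theorem, Unitary.conjStarAlgAut_apply]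
    rfl

lemma map_linImage_unitary [DecidableEq ι] {U : Matrix ι ι ℂ} (hU : U * Uᴴ = 1) :
    (gaussianArray ι κ 1).map (linImage U) = gaussianArray ι κ 1 := by
  rw [map_linImage_eq U (1 : Matrix ι ι ℂ) (by simpa using hU)]
  have : (linImage (1 : Matrix ι ι ℂ) : (ι → κ → ℂ) → _) = id := funext fun Z => linImage_one Z
  rw [this, Measure.map_id]

lemma pairing_diagonal [DecidableEq ι] (d : ι → ℝ) (Z : ι → κ → ℂ) :
    pairing Z (linImage (Matrix.diagonal fun i => (d i : ℂ)) Z) = ∑ i, d i * ∑ k, ‖Z i k‖ ^ 2 := by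
  have h : linImage (Matrix.diagonal fun i => (d i : ℂ)) Z = fun i k => (d i : ℂ) * Z i k := by
    funext i k
    simp [linImage, Matrix.diagonal_apply]
  simp only [h, pairing, Finset.mul_sum]
  refine Finset.sum_congr rfl fun i _ => Finset.sum_congr rfl fun k _ => ?_
  rw [Complex.sq_norm, Complex.normSq_apply]
  simp [Complex.mul_re, Complex.mul_im]
  ring

/-- The Gaussian integral of the exponential of a Hermitian form, `|I + R|^{-κ}`. -/
theorem lintegral_exp_neg_quadraticForm [DecidableEq ι] {R : Matrix ι ι ℂ}
    (hR : (1 + R).PosDef) :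
    ∫⁻ Z, ENNReal.ofReal (Real.exp (-pairing Z (linImage R Z))) ∂(gaussianArray ι κ 1) =
      ENNReal.ofReal (((1 + R).det.re)⁻¹ ^ Fintype.card κ) := by
  have hH : R.IsHermitian := by
    simpa using hR.isHermitian.sub (Matrix.isHermitian_one (n := ι) (α := ℂ))
  obtain ⟨U, hU1, hU2, hU⟩ := exists_unitary_diagonal hH
  set d := hH.eigenvalues
  have hdiag : 1 + R = U * Matrix.diagonal (fun i => ((1 + d i : ℝ) : ℂ)) * Uᴴ := by
    have : (Matrix.diagonal fun i => ((1 + d i : ℝ) : ℂ)) =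
        1 + Matrix.diagonal fun i => (d i : ℂ) := by
      rw [← Matrix.diagonal_one, Matrix.diagonal_add]
      push_cast; rfl
    rw [this, Matrix.mul_add, Matrix.add_mul, ← hU, Matrix.mul_one, hU2]
  have hd : ∀ i, 0 < 1 + d i := by
    have h2 : (Matrix.diagonal fun i => ((1 + d i : ℝ) : ℂ)).PosDef := by
      have := hR.conjTranspose_mul_mul_same (B := U)
        (Function.HasLeftInverse.injective ⟨Uᴴ.mulVec, fun x => by
          rw [Matrix.mulVec_mulVec, hU1, Matrix.one_mulVec]⟩)
      rwa [hdiag, ← Matrix.mul_assoc, ← Matrix.mul_assoc, hU1, Matrix.one_mul, Matrix.mul_assoc,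
        hU1, Matrix.mul_one] at this
    intro i
    have := Matrix.posDef_diagonal_iff.1 h2 i
    exact_mod_cast this
  have hdet : (1 + R).det = ((∏ i, (1 + d i) : ℝ) : ℂ) := by
    rw [hdiag, Matrix.det_mul, Matrix.det_mul, mul_right_comm, ← Matrix.det_mul, hU2,
      Matrix.det_one, one_mul, Matrix.det_diagonal]
    push_cast; rfl
  have hform : ∀ Z : ι → κ → ℂ, pairing Z (linImage R Z) =
      ∑ i, d i * ∑ k, ‖linImage Uᴴ Z i k‖ ^ 2 := by
    intro Z
    rw [← pairing_diagonal, ← pairing_linImage U, linImage_linImage, linImage_linImage,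
      ← hU]
  simp_rw [hform]
  rw [← lintegral_map (f := fun Z : ι → κ → ℂ =>
      ENNReal.ofReal (Real.exp (-∑ i, d i * ∑ k, ‖Z i k‖ ^ 2))) _ (measurable_linImage Uᴴ),
    map_linImage_unitary (by rwa [Matrix.conjTranspose_conjTranspose]),
    lintegral_exp_weighted_energy d hd, hdet, Complex.ofReal_re]
  fun_prop

/-! ### The energy of a standard Gaussian array is Gamma distributed -/

lemma mgf_gammaMeasure {a : ℝ} (ha : 0 < a) {t : ℝ} (ht : t < 1) :
    mgf id (gammaMeasure a 1) t = (1 / (1 - t)) ^ a := by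
  have h1 : gammaMeasure a 1 = volume.withDensity fun x => ENNReal.ofReal (gammaPDFReal a 1 x) := rfl
  rw [mgf, h1, integral_withDensity_eq_integral_toReal_smul
    (measurable_gammaPDFReal a 1).ennreal_ofReal (by simp)]
  have h : ∀ x : ℝ, (ENNReal.ofReal (gammaPDFReal a 1 x)).toReal • Real.exp (t * id x) =
      (Set.Ici (0 : ℝ)).indicator (fun x : ℝ =>
        (1 / Real.Gamma a) * (x ^ (a - 1) * Real.exp (-((1 - t) * x)))) x := by
    intro x
    rw [ENNReal.toReal_ofReal (gammaPDFReal_nonneg ha one_pos x), gammaPDFReal]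
    by_cases hx : 0 ≤ x
    · rw [Set.indicator_of_mem (by exact hx), if_pos hx, smul_eq_mul]
      have : Real.exp (-((1 - t) * x)) = Real.exp (-(1 * x)) * Real.exp (t * id x) := by
        rw [← Real.exp_add]; congr 1; simp only [id]; ring
      rw [this, Real.one_rpow]
      ring
    · rw [Set.indicator_of_notMem (by exact hx), if_neg hx, zero_smul]
  simp_rw [h]
  rw [integral_indicator measurableSet_Ici, integral_Ici_eq_integral_Ioi, integral_const_mul,
    Real.integral_rpow_mul_exp_neg_mul_Ioi ha (by linarith)]
  have := (Real.Gamma_pos_of_pos ha).ne'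
  field_simp

/-- The characteristic function of the Gamma law with integer shape, by analytic continuation of
the moment generating function. -/
lemma charFun_gammaMeasure {N : ℕ} (hN : 0 < N) (s : ℝ) :
    charFun (gammaMeasure N 1) s = (1 - s * Complex.I)⁻¹ ^ N := by
  have hN' : (0 : ℝ) < N := by exact_mod_cast hN
  have hint : Set.Iio (1 : ℝ) ⊆ interior (integrableExpSet id (gammaMeasure N 1)) := by
    refine interior_maximal (fun t ht => ?_) isOpen_Iio
    -- A nonzero moment generating function cannot come from a divergent integral.
    by_contra hcon
    have := mgf_gammaMeasure hN' ht
    rw [mgf, integral_undef hcon] at this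
    have h1 : 0 < 1 - t := by simpa using ht
    exact (Real.rpow_pos_of_pos (one_div_pos.2 h1) _).ne this
  have hset : {z : ℂ | z.re < 1} = Complex.reLm ⁻¹' Set.Iio (1 : ℝ) := rfl
  have hf : AnalyticOnNhd ℂ (complexMGF id (gammaMeasure N 1)) {z : ℂ | z.re < 1} :=
    analyticOnNhd_complexMGF.mono fun z hz => hint hz
  have hg : AnalyticOnNhd ℂ (fun z : ℂ => (1 - z)⁻¹ ^ N) {z : ℂ | z.re < 1} := by
    intro z hz
    have : 1 - z ≠ 0 := fun h => by
      have h2 : z = 1 := (sub_eq_zero.1 h).symm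
      simp [h2] at hz
    exact ((analyticAt_const.sub analyticAt_id).inv this).pow N
  have heq := AnalyticOnNhd.eqOn_of_preconnected_of_frequently_eq hf hg
    (by rw [hset]; exact ((convex_Iio 1).linear_preimage Complex.reLm).isPreconnected)
    (z₀ := ((0 : ℝ) : ℂ)) (by simp) ?_
  · rw [← complexMGF_id_mul_I, heq (by simp)]
  have h_real : ∃ᶠ x : ℝ in nhdsWithin 0 {0}ᶜ,
      complexMGF id (gammaMeasure N 1) x = (1 - (x : ℂ))⁻¹ ^ N := by
    refine Filter.Eventually.frequently ?_
    filter_upwards [mem_nhdsWithin_of_mem_nhds (Iio_mem_nhds one_pos)] with x hx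
    rw [complexMGF_ofReal, mgf_gammaMeasure hN' hx, Real.rpow_natCast]
    push_cast
    rw [one_div]
  rw [Filter.frequently_iff_seq_forall] at h_real ⊢
  obtain ⟨xs, hx_tendsto, hx_eq⟩ := h_real
  refine ⟨fun n => xs n, ?_, fun n => hx_eq n⟩
  rw [tendsto_nhdsWithin_iff] at hx_tendsto ⊢
  refine ⟨?_, by simpa using hx_tendsto.2⟩
  exact (Complex.continuous_ofReal.tendsto 0).comp hx_tendsto.1

/-- The energy of a standard Gaussian array with `N` entries has the `Gamma(N, 1)` law. -/
theorem map_energy_gaussianArray [Nonempty ι] [Nonempty κ] :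
    (gaussianArray ι κ 1).map energy =
      gammaMeasure ((Fintype.card ι * Fintype.card κ : ℕ) : ℝ) 1 := by
  have hN : (0 : ℝ) < ((Fintype.card ι * Fintype.card κ : ℕ) : ℝ) := by
    exact_mod_cast Nat.mul_pos Fintype.card_pos Fintype.card_pos
  have : IsProbabilityMeasure (gammaMeasure ((Fintype.card ι * Fintype.card κ : ℕ) : ℝ) 1) :=
    isProbabilityMeasure_gammaMeasure hN one_pos
  have : IsProbabilityMeasure ((gaussianArray ι κ 1).map energy) :=
    Measure.isProbabilityMeasure_map continuous_energy.measurable.aemeasurable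
  refine Measure.ext_of_charFun (funext fun s => ?_)
  rw [charFun_gammaMeasure (by exact_mod_cast hN), charFun_apply_real,
    integral_map continuous_energy.measurable.aemeasurable
      (Continuous.aestronglyMeasurable (by fun_prop))]
  have h := integral_exp_weighted_energy (ι := ι) (κ := κ) (fun _ => -(s * Complex.I))
    (fun _ => by simp)
  rw [Finset.prod_const, ← pow_mul, Finset.card_univ] at h
  rw [sub_eq_add_neg, Nat.mul_comm, ← h]
  refine integral_congr_ae (Filter.Eventually.of_forall fun Z => ?_)
  simp only [energy, Complex.ofReal_sum]
  rw [← Finset.mul_sum]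
  congr 1
  ring

lemma gammaMeasure_real_Iic {a : ℝ} (ha : 0 < a) (x : ℝ) :
    (gammaMeasure a 1).real (Set.Iic x) = lowerGamma a x / Real.Gamma a := by
  have := isProbabilityMeasure_gammaMeasure ha one_pos
  rw [← cdf_eq_real, cdf_gammaMeasure_eq_integral ha one_pos, lowerGamma, div_eq_inv_mul,
    ← integral_const_mul, ← integral_indicator measurableSet_Iic,
    ← integral_indicator measurableSet_Ioc]
  refine integral_congr_ae ?_
  have h0 : ∀ᵐ t : ℝ, t ≠ 0 := by simp [ae_iff]
  filter_upwards [h0] with t ht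
  simp only [Set.indicator_apply, Set.mem_Iic, Set.mem_Ioc, gammaPDFReal]
  rcases lt_or_gt_of_ne ht with h | h
  · simp [h.not_ge, h.not_gt]
  · by_cases hx : t ≤ x
    · simp only [hx, h, h.le, and_self, if_true, Real.one_rpow, one_mul]
      ring
    · simp [hx]

/-- The tail of the energy of a standard Gaussian array. -/
theorem gaussianArray_energy_gt [Nonempty ι] [Nonempty κ] {N : ℝ}
    (hN : N = Fintype.card ι * Fintype.card κ) (x : ℝ) :
    gaussianArray ι κ 1 {Z | x < energy Z} =
      ENNReal.ofReal (1 - lowerGamma N x / Real.Gamma N) := by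
  have hN' : N = ((Fintype.card ι * Fintype.card κ : ℕ) : ℝ) := by rw [hN]; push_cast; rfl
  have hpos : 0 < N := by
    rw [hN']; exact_mod_cast Nat.mul_pos Fintype.card_pos Fintype.card_pos
  have := isProbabilityMeasure_gammaMeasure hpos one_pos
  have h : {Z : ι → κ → ℂ | x < energy Z} = energy ⁻¹' Set.Ioi x := rfl
  rw [h, ← Measure.map_apply continuous_energy.measurable measurableSet_Ioi,
    map_energy_gaussianArray, ← hN', ← gammaMeasure_real_Iic hpos, ← ofReal_measureReal,
    ← probReal_compl_eq_one_sub measurableSet_Iic, Set.compl_Iic]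

lemma lowerGamma_div_Gamma_le_one {a : ℝ} (ha : 0 < a) (x : ℝ) :
    lowerGamma a x / Real.Gamma a ≤ 1 := by
  have := isProbabilityMeasure_gammaMeasure ha one_pos
  rw [← gammaMeasure_real_Iic ha]
  exact measureReal_le_one

end QuadraticForms

/-! ### Positivity of the Chernoff exponent -/

section Positivity

set_option linter.unusedSectionVars false

open scoped ComplexOrder
open Matrix

variable {ι m n : Type} [Fintype ι] [Fintype m] [Fintype n]

lemma posDef_of_re_pos {M : Matrix ι ι ℂ} (hM : M.IsHermitian)
    (h : ∀ x : ι → ℂ, ‖x‖ = 1 → 0 < (star x ⬝ᵥ (M *ᵥ x)).re) : M.PosDef := by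
  refine .of_dotProduct_mulVec_pos hM fun x hx => ?_
  have him : (star x ⬝ᵥ (M *ᵥ x)).im = 0 := hM.im_star_dotProduct_mulVec_self x
  have hn : ‖x‖ ≠ 0 := norm_ne_zero_iff.2 hx
  have h1 := h ((‖x‖⁻¹ : ℝ) • x) (by rw [norm_smul]; simp [hn])
  rw [star_smul, mulVec_smul, dotProduct_smul, smul_dotProduct, Complex.smul_re, star_trivial,
    Complex.smul_re, smul_eq_mul, smul_eq_mul] at h1
  rw [Complex.pos_iff]
  refine ⟨?_, him.symm⟩
  have h2 : 0 < ‖x‖⁻¹ := by positivity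
  exact pos_of_mul_pos_right (pos_of_mul_pos_right h1 h2.le) h2.le

lemma posSemidef_of_re_nonneg {M : Matrix ι ι ℂ} (hM : M.IsHermitian)
    (h : ∀ x : ι → ℂ, ‖x‖ = 1 → 0 ≤ (star x ⬝ᵥ (M *ᵥ x)).re) : M.PosSemidef := by
  refine .of_dotProduct_mulVec_nonneg hM fun x => ?_
  rcases eq_or_ne x 0 with rfl | hx
  · simp
  have him : (star x ⬝ᵥ (M *ᵥ x)).im = 0 := hM.im_star_dotProduct_mulVec_self x
  have hn : ‖x‖ ≠ 0 := norm_ne_zero_iff.2 hx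
  have h1 := h ((‖x‖⁻¹ : ℝ) • x) (by rw [norm_smul]; simp [hn])
  rw [star_smul, mulVec_smul, dotProduct_smul, smul_dotProduct, Complex.smul_re, star_trivial,
    Complex.smul_re, smul_eq_mul, smul_eq_mul] at h1
  rw [Complex.nonneg_iff]
  refine ⟨?_, him.symm⟩
  have h2 : 0 < ‖x‖⁻¹ := by positivity
  exact nonneg_of_mul_nonneg_right (nonneg_of_mul_nonneg_right h1 h2) h2

/-- Along a continuous path of invertible Hermitian matrices, positivity cannot be lost. -/
theorem posDef_of_path [DecidableEq ι] {F : ℝ → Matrix ι ι ℂ} (hF : Continuous F)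
    (hH : ∀ t, (F t).IsHermitian) (h0 : (F 0).PosSemidef)
    (hdet : ∀ t ∈ Set.Icc (0 : ℝ) 1, (F t).det ≠ 0) : (F 1).PosDef := by
  set q : ℝ × (ι → ℂ) → ℝ := fun p => (star p.2 ⬝ᵥ (F p.1 *ᵥ p.2)).re with hq
  have hqc : Continuous q := by
    refine Complex.continuous_re.comp ?_
    exact (continuous_snd.star).dotProduct ((hF.comp continuous_fst).matrix_mulVec continuous_snd)
  -- The times at which the form is nonpositive at some unit vector. At the first such time the form
  -- is still positive semidefinite and, by invertibility, even positive definite.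
  set B : Set ℝ := Prod.fst '' ((Set.Icc (0 : ℝ) 1 ×ˢ Metric.sphere (0 : ι → ℂ) 1) ∩ {p | q p ≤ 0})
    with hB
  have hBc : IsCompact B :=
    ((isCompact_Icc.prod (isCompact_sphere _ _)).inter_right
      (isClosed_le hqc continuous_const)).image continuous_fst
  have hgood : ∀ t ∈ Set.Icc (0 : ℝ) 1, t ∉ B → ∀ x : ι → ℂ, ‖x‖ = 1 → 0 < q (t, x) := by
    intro t ht htB x hx
    by_contra hcon
    exact htB ⟨(t, x), ⟨⟨ht, by simpa using hx⟩, not_lt.1 hcon⟩, rfl⟩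
  by_contra hcon
  have h1B : (1 : ℝ) ∈ B := by
    by_contra h1
    exact hcon (posDef_of_re_pos (hH 1) (hgood 1 (by simp) h1))
  obtain ⟨t, htB, hmin⟩ := hBc.exists_isLeast ⟨1, h1B⟩
  have ht01 : t ∈ Set.Icc (0 : ℝ) 1 := by
    obtain ⟨p, ⟨⟨hp, _⟩, _⟩, rfl⟩ := htB
    exact hp
  have hpsd : (F t).PosSemidef := by
    refine posSemidef_of_re_nonneg (hH t) fun x hx => ?_
    rcases eq_or_lt_of_le ht01.1 with h | h
    · rw [← h]
      exact h0.re_dotProduct_nonneg x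
    · have hsub : Set.Ico 0 t ⊆ {s | 0 ≤ q (s, x)} := fun s hs =>
        (hgood s ⟨hs.1, hs.2.le.trans ht01.2⟩ (fun hsB => (hmin hsB).not_gt hs.2) x hx).le
      have hcl : IsClosed {s | 0 ≤ q (s, x)} :=
        isClosed_le continuous_const (hqc.comp (by fun_prop))
      have := closure_minimal hsub hcl
      rw [closure_Ico h.ne] at this
      exact this ⟨h.le, le_rfl⟩
  have hpd : (F t).PosDef := hpsd.posDef_iff_det_ne_zero.2 (hdet t ht01)
  obtain ⟨⟨t', x⟩, ⟨⟨_, hx⟩, hle⟩, rfl⟩ := htB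
  have hx0 : x ≠ 0 := by
    rintro rfl
    simp at hx
  exact absurd (hpd.re_dotProduct_pos hx0) (not_lt.2 hle)

variable [DecidableEq n]

/-- The matrix of the Hermitian form `r |g|² + 2 u Re ⟨g, v⟩ + u |v|²`. -/
noncomputable def chernoffForm (n : Type) [DecidableEq n] (u r : ℝ) : Matrix (n ⊕ n) (n ⊕ n) ℂ :=
  fromBlocks ((r : ℂ) • 1) ((u : ℂ) • 1) ((u : ℂ) • 1) ((u : ℂ) • 1)

/-- The complex form of the matrix `D`, for `X = Σ₁` and `I + Θ = C`. -/
noncomputable def chernoffMatrix (C X : Matrix n n ℂ) (u r : ℝ) : Matrix n n ℂ :=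
  1 + (u : ℂ) • X + ((r - u : ℝ) : ℂ) • ((1 + (u : ℂ) • X) * C) + (u : ℂ) • C

lemma isHermitian_chernoffForm (u r : ℝ) : (chernoffForm n u r).IsHermitian := by
  unfold chernoffForm
  refine IsHermitian.fromBlocks ?_ ?_ ?_
  · simp [IsHermitian, conjTranspose_smul]
  · simp [conjTranspose_smul]
  · simp [IsHermitian, conjTranspose_smul]

/-- The determinant of the Hermitian form that governs the Gaussian integral only depends on the
covariance `diag(C, X)`, and is the determinant of a nonsymmetric matrix of half the size. -/
lemma det_one_add_chernoffForm [DecidableEq m] (C X : Matrix n n ℂ) (u r : ℝ)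
    (P : Matrix (n ⊕ n) m ℂ) (hP : P * Pᴴ = fromBlocks C 0 0 X) :
    (1 + Pᴴ * chernoffForm n u r * P).det = (chernoffMatrix C X u r).det := by
  have h1 : (1 + Pᴴ * chernoffForm n u r * P).det =
      (fromBlocks (1 + (r : ℂ) • C) ((u : ℂ) • X) ((u : ℂ) • C) (1 + (u : ℂ) • X)).det := by
    rw [Matrix.mul_assoc, det_one_add_mul_comm, Matrix.mul_assoc, hP, chernoffForm,
      fromBlocks_multiply, ← fromBlocks_one, fromBlocks_add]
    simp
  set c : Matrix n n ℂ := 1 + (u : ℂ) • X with hc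
  set a : Matrix n n ℂ := 1 + ((r - u : ℝ) : ℂ) • C with ha
  -- Row and column operations clear the upper left block.
  have h2 : fromBlocks (1 : Matrix n n ℂ) (-1) 0 1 *
      fromBlocks (1 + (r : ℂ) • C) ((u : ℂ) • X) ((u : ℂ) • C) c *
      fromBlocks 1 1 0 1 * fromBlocks (1 : Matrix n n ℂ) 0 (-1) 1 =
      fromBlocks 1 (a - 1) (-c) ((u : ℂ) • C + c) := by
    simp only [fromBlocks_multiply]
    congr 1 <;> simp [ha, hc, sub_smul] <;> abel
  have h3 := congrArg det h2
  rw [det_mul, det_mul, det_mul, det_fromBlocks_zero₂₁, det_fromBlocks_zero₂₁,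
    det_fromBlocks_zero₁₂, det_fromBlocks_one₁₁] at h3
  simp only [det_one, mul_one, one_mul] at h3
  rw [h1, h3]
  congr 1
  rw [chernoffMatrix, ← hc, ha]
  simp only [add_sub_cancel_left, Matrix.neg_mul, Matrix.mul_smul, smul_neg, sub_neg_eq_add]
  abel

lemma posSemidef_fromBlocks_one : (fromBlocks 1 1 1 1 : Matrix (n ⊕ n) (n ⊕ n) ℂ).PosSemidef := by
  have h := posSemidef_conjTranspose_mul_self (fromCols (1 : Matrix n n ℂ) (1 : Matrix n n ℂ))
  rwa [conjTranspose_fromCols_eq_fromRows_conjTranspose, conjTranspose_one, fromRows_mul_fromCols,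
    Matrix.one_mul] at h

lemma posSemidef_fromBlocks_one_zero :
    (fromBlocks 1 0 0 0 : Matrix (n ⊕ n) (n ⊕ n) ℂ).PosSemidef := by
  have h := posSemidef_conjTranspose_mul_self (fromCols (1 : Matrix n n ℂ) (0 : Matrix n n ℂ))
  rw [conjTranspose_fromCols_eq_fromRows_conjTranspose, conjTranspose_one, fromRows_mul_fromCols]
    at h
  simpa using h

lemma posSemidef_chernoffForm {u r : ℝ} (hu : 0 ≤ u) (hr : u ≤ r) :
    (chernoffForm n u r).PosSemidef := by
  have h : chernoffForm n u r = ((r - u : ℝ) : ℂ) • (fromBlocks 1 0 0 0 : Matrix (n ⊕ n) (n ⊕ n) ℂ)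
      + (u : ℂ) • (fromBlocks 1 1 1 1 : Matrix (n ⊕ n) (n ⊕ n) ℂ) := by
    rw [chernoffForm, fromBlocks_smul, fromBlocks_smul, fromBlocks_add]
    simp [sub_smul]
  rw [h]
  exact (posSemidef_fromBlocks_one_zero.smul (by exact_mod_cast sub_nonneg.2 hr)).add
    (posSemidef_fromBlocks_one.smul (by exact_mod_cast hu))

/-- Along the segment from `C = (u - r)⁻¹ I`, `X = (r / (u (u - r))) I` to the given covariances,
the matrix stays in the pencil spanned by the identity and its final value. -/
lemma chernoffMatrix_path {C X : Matrix n n ℂ} {u r : ℝ} (hur : r < u) (hu : u ≠ 0) (t : ℝ) :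
    chernoffMatrix ((t : ℂ) • C + (((1 - t) / (u - r) : ℝ) : ℂ) • 1)
      ((t : ℂ) • X + (((1 - t) * ((u / (u - r) - 1) / u) : ℝ) : ℂ) • 1) u r =
    ((u / (u - r) * (1 - t ^ 2) : ℝ) : ℂ) • 1 + ((t ^ 2 : ℝ) : ℂ) • chernoffMatrix C X u r := by
  have hs : ((u : ℂ) - r) ≠ 0 := by
    rw [← Complex.ofReal_sub]; exact_mod_cast (sub_pos.2 hur).ne'
  have hu' : (u : ℂ) ≠ 0 := by exact_mod_cast hu
  simp only [chernoffMatrix, Matrix.add_mul, Matrix.mul_add, Matrix.one_mul, Matrix.smul_mul,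
    Matrix.mul_smul, smul_add, smul_smul, Matrix.mul_one]
  push_cast
  match_scalars <;> field_simp <;> ring

/-- If the (nonsymmetric) matrix `D` has no eigenvalue in `(-∞, 0]`, then the Hermitian form that
governs the Gaussian integral is positive definite. For `r ≥ u` this is clear. For `r < u`, the
covariances are deformed to multiples of the identity in such a way that `D` becomes
`a (1 - t²) I + t² D`, which stays invertible. -/
theorem posDef_one_add_chernoffForm [DecidableEq m] (C X : Matrix n n ℂ) {u r : ℝ} (hu : 0 ≤ u)
    (hr : 0 ≤ r) (P : Matrix (n ⊕ n) m ℂ) (hP : P * Pᴴ = fromBlocks C 0 0 X)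
    (hD : ∀ x : ℝ, 0 ≤ x → ((x : ℂ) • 1 + chernoffMatrix C X u r).det ≠ 0) :
    (1 + Pᴴ * chernoffForm n u r * P).PosDef := by
  rcases le_or_gt u r with hur | hur
  · exact PosDef.one.add_posSemidef ((posSemidef_chernoffForm hu hur).conjTranspose_mul_mul_same P)
  have hs : 0 < u - r := sub_pos.2 hur
  have hu0 : 0 < u := hr.trans_lt hur
  set a : ℝ := u / (u - r) with ha
  have ha1 : 1 ≤ a := by rw [ha, le_div_iff₀ hs]; linarith
  set P₀ : Matrix (n ⊕ n) (n ⊕ n) ℂ := fromBlocks ((√(1 / (u - r)) : ℂ) • 1) 0 0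
    ((√((a - 1) / u) : ℂ) • 1) with hP₀
  have hsq : ∀ y : ℝ, 0 ≤ y → (√y : ℂ) * (√y : ℂ) = (y : ℂ) := fun y hy => by
    rw [← Complex.ofReal_mul, Real.mul_self_sqrt hy]
  -- `Q t` is a factor of the covariance interpolated between `P₀ P₀ᴴ` at `0` and `P Pᴴ` at `1`.
  set Q : ℝ → Matrix (n ⊕ n) (m ⊕ (n ⊕ n)) ℂ := fun t =>
    fromCols ((√t : ℂ) • P) ((√(1 - t) : ℂ) • P₀) with hQ
  have hQQ : ∀ t ∈ Set.Icc (0 : ℝ) 1, Q t * (Q t)ᴴ =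
      fromBlocks ((t : ℂ) • C + (((1 - t) / (u - r) : ℝ) : ℂ) • 1) 0 0
        ((t : ℂ) • X + (((1 - t) * ((a - 1) / u) : ℝ) : ℂ) • 1) := by
    intro t ht
    have hP₀' : P₀ * P₀ᴴ = fromBlocks (((1 / (u - r) : ℝ) : ℂ) • 1) 0 0
        ((((a - 1) / u : ℝ) : ℂ) • 1) := by
      rw [hP₀, fromBlocks_conjTranspose, fromBlocks_multiply]
      simp only [conjTranspose_smul, conjTranspose_one, conjTranspose_zero, Matrix.mul_zero,
        Matrix.zero_mul, add_zero, zero_add, Matrix.smul_mul, Matrix.mul_smul, Matrix.one_mul,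
        smul_smul, smul_zero, RCLike.star_def, Complex.conj_ofReal]
      rw [hsq _ (by positivity), hsq _ (div_nonneg (by linarith) hu0.le)]
    rw [hQ]
    simp only
    rw [conjTranspose_fromCols_eq_fromRows_conjTranspose, fromCols_mul_fromRows]
    simp only [conjTranspose_smul, Matrix.smul_mul, Matrix.mul_smul, smul_smul, RCLike.star_def,
        Complex.conj_ofReal]
    rw [hsq _ ht.1, hsq _ (by linarith [ht.2]), hP, hP₀', fromBlocks_smul, fromBlocks_smul,
      fromBlocks_add]
    simp only [smul_smul, smul_zero, add_zero]
    push_cast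
    simp only [mul_one_div]
  set F : ℝ → Matrix (m ⊕ (n ⊕ n)) (m ⊕ (n ⊕ n)) ℂ := fun t =>
    1 + (Q t)ᴴ * chernoffForm n u r * Q t with hF
  have hFblocks : ∀ t, F t = fromBlocks
      (1 + ((√t : ℂ) • P)ᴴ * chernoffForm n u r * ((√t : ℂ) • P))
      (((√t : ℂ) • P)ᴴ * chernoffForm n u r * ((√(1 - t) : ℂ) • P₀))
      (((√(1 - t) : ℂ) • P₀)ᴴ * chernoffForm n u r * ((√t : ℂ) • P))
      (1 + ((√(1 - t) : ℂ) • P₀)ᴴ * chernoffForm n u r * ((√(1 - t) : ℂ) • P₀)) := by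
    intro t
    rw [hF, hQ]
    simp only
    rw [conjTranspose_fromCols_eq_fromRows_conjTranspose, fromRows_mul, fromRows_mul_fromCols,
      ← fromBlocks_one, fromBlocks_add]
    simp
  have hFH : ∀ t, (F t).IsHermitian := fun t =>
    isHermitian_one.add (isHermitian_conjTranspose_mul_mul _ (isHermitian_chernoffForm u r))
  have hFc : Continuous F := by
    have hQc : Continuous Q := by
      refine continuous_matrix fun i j => ?_
      rcases j with j | j
      · simp only [hQ, fromCols_apply_inl, Matrix.smul_apply]
        fun_prop
      · simp only [hQ, fromCols_apply_inr, Matrix.smul_apply]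
        fun_prop
    exact continuous_const.add ((hQc.matrix_conjTranspose.matrix_mul continuous_const).matrix_mul
      hQc)
  have hF0 : (F 0).PosSemidef := by
    have hb : √(1 / (u - r)) * (u * √((a - 1) / u)) ≤ a := by
      have h1 : √(1 / (u - r)) * √((a - 1) / u) ≤ 1 / (u - r) := by
        rw [← Real.sqrt_mul (by positivity), Real.sqrt_le_left (by positivity)]
        have : 1 / (u - r) * ((a - 1) / u) = (1 / (u - r)) ^ 2 * ((a - 1) / a) := by
          rw [ha]; field_simp
        rw [this]
        refine mul_le_of_le_one_right (by positivity) ?_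
        rw [div_le_one (by linarith)]
        linarith
      calc _ = u * (√(1 / (u - r)) * √((a - 1) / u)) := by ring
        _ ≤ u * (1 / (u - r)) := mul_le_mul_of_nonneg_left h1 hu0.le
        _ = a := by rw [ha]; ring
    set β : ℝ := √(1 / (u - r)) * (u * √((a - 1) / u)) with hβ
    have hβ0 : 0 ≤ β := by positivity
    -- At the start of the path the form is `a |g|² + 2 β Re ⟨g, v⟩ + a |v|²` with `β ≤ a`.
    have h1 : 1 + P₀ᴴ * chernoffForm n u r * P₀ = ((a - β : ℝ) : ℂ) • 1 + (β : ℂ) •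
        (fromBlocks 1 1 1 1 : Matrix (n ⊕ n) (n ⊕ n) ℂ) := by
      have e1 : (1 : ℂ) + ((√(1 / (u - r)) : ℝ) : ℂ) * r * ((√(1 / (u - r)) : ℝ) : ℂ) = a := by
        rw [mul_right_comm, hsq _ (by positivity), ← Complex.ofReal_mul, ← Complex.ofReal_one,
          ← Complex.ofReal_add, ha]
        congr 1
        field_simp
        ring
      have e2 : (1 : ℂ) + ((√((a - 1) / u) : ℝ) : ℂ) * u * ((√((a - 1) / u) : ℝ) : ℂ) = a := by
        rw [mul_right_comm, hsq _ (div_nonneg (by linarith) hu0.le), ← Complex.ofReal_mul,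
          ← Complex.ofReal_one, ← Complex.ofReal_add]
        congr 1
        field_simp
        ring
      have e3 : ((√(1 / (u - r)) : ℝ) : ℂ) * u * ((√((a - 1) / u) : ℝ) : ℂ) = β := by
        rw [hβ]; push_cast; ring
      have e4 : ((√((a - 1) / u) : ℝ) : ℂ) * u * ((√(1 / (u - r)) : ℝ) : ℂ) = β := by
        rw [hβ]; push_cast; ring
      rw [hP₀, chernoffForm, fromBlocks_conjTranspose, fromBlocks_multiply, fromBlocks_multiply,
        ← fromBlocks_one, fromBlocks_add, fromBlocks_smul, fromBlocks_smul, fromBlocks_add]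
      simp only [conjTranspose_smul, conjTranspose_one, conjTranspose_zero, Matrix.mul_zero,
        Matrix.zero_mul, add_zero, zero_add, Matrix.smul_mul, Matrix.mul_smul, Matrix.one_mul,
        smul_smul, RCLike.star_def, Complex.conj_ofReal, smul_zero]
      congr 1
      · match_scalars
        linear_combination e1
      · match_scalars
        linear_combination e3
      · match_scalars
        linear_combination e4
      · match_scalars
        linear_combination e2
    have h2 : (1 + P₀ᴴ * chernoffForm n u r * P₀).PosSemidef := by
      rw [h1]
      exact (PosSemidef.one.smul (by exact_mod_cast sub_nonneg.2 hb)).add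
        (posSemidef_fromBlocks_one.smul (by exact_mod_cast hβ0))
    have h3 : F 0 = fromBlocks (1 : Matrix m m ℂ) 0 (0 : Matrix m (n ⊕ n) ℂ)ᴴ
        (1 + P₀ᴴ * chernoffForm n u r * P₀) := by
      rw [hFblocks]
      simp
    rw [h3]
    let _ : Invertible (1 : Matrix m m ℂ) := invertibleOne
    rw [PosDef.fromBlocks₁₁ 0 _ PosDef.one]
    simpa using h2
  have hdet : ∀ t ∈ Set.Icc (0 : ℝ) 1, (F t).det ≠ 0 := by
    intro t ht
    rw [hF]
    simp only
    rw [det_one_add_chernoffForm _ _ u r (Q t) (hQQ t ht), ha, chernoffMatrix_path hur hu0.ne']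
    rcases eq_or_lt_of_le ht.1 with rfl | ht0
    · have : u / (u - r) ≠ 0 := by positivity
      simp [hu0.ne', sub_eq_zero, hur.ne']
    · have ht2 : ((t ^ 2 : ℝ) : ℂ) ≠ 0 := by
        exact_mod_cast (pow_pos ht0 2).ne'
      have h4 : ((u / (u - r) * (1 - t ^ 2) : ℝ) : ℂ) • 1 +
          ((t ^ 2 : ℝ) : ℂ) • chernoffMatrix C X u r = ((t ^ 2 : ℝ) : ℂ) •
            (((u / (u - r) * (1 - t ^ 2) / t ^ 2 : ℝ) : ℂ) • 1 + chernoffMatrix C X u r) := by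
        rw [smul_add, smul_smul, ← Complex.ofReal_mul, mul_div_cancel₀ _ (pow_pos ht0 2).ne']
      rw [h4, det_smul]
      refine mul_ne_zero (pow_ne_zero _ ht2) (hD _ ?_)
      have : 0 ≤ 1 - t ^ 2 := by nlinarith [ht.1, ht.2]
      positivity
  -- At `t = 1` the upper left block of `F t` is the matrix in question.
  have h1 := posDef_of_path hFc hFH hF0 hdet
  have h2 := h1.submatrix (e := Sum.inl) Sum.inl_injective
  rw [hFblocks] at h2
  have h3 : ∀ (A : Matrix m m ℂ) (B : Matrix m (n ⊕ n) ℂ) (B' : Matrix (n ⊕ n) m ℂ)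
      (E : Matrix (n ⊕ n) (n ⊕ n) ℂ), (fromBlocks A B B' E).submatrix Sum.inl Sum.inl = A :=
    fun _ _ _ _ => rfl
  rw [h3] at h2
  simpa using h2

end Positivity

/-! ### Real forms of complex matrices -/

section Realify

variable {n : ℕ}

lemma realify_add (X Y : Matrix (Fin n) (Fin n) ℂ) : realify (X + Y) = realify X + realify Y := by
  rw [realify, realify, realify, Matrix.fromBlocks_add]
  congr 1
  ext i j
  simp [add_comm]

lemma realify_smul (c : ℝ) (X : Matrix (Fin n) (Fin n) ℂ) :
    realify ((c : ℂ) • X) = c • realify X := by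
  rw [realify, realify, Matrix.fromBlocks_smul]
  congr 1 <;> ext i j <;> simp

lemma realify_one : realify (1 : Matrix (Fin n) (Fin n) ℂ) = 1 := by
  rw [realify, ← Matrix.fromBlocks_one]
  congr 1 <;> ext i j <;> by_cases h : i = j <;> simp [Matrix.one_apply, h]

lemma realify_mul (X Y : Matrix (Fin n) (Fin n) ℂ) : realify (X * Y) = realify X * realify Y := by
  rw [realify, realify, realify, Matrix.fromBlocks_multiply]
  congr 1 <;> ext i j <;>
    simp [Matrix.mul_apply, Complex.re_sum, Complex.im_sum, Finset.sum_add_distrib,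
      sub_eq_add_neg, add_comm]

/-- Over `ℂ`, the real form of `X` is similar to a block triangular matrix with diagonal blocks
`X` and its entrywise conjugate. -/
lemma det_realify (X : Matrix (Fin n) (Fin n) ℂ) :
    (realify X).det = Complex.normSq X.det := by
  apply Complex.ofReal_injective
  have h1 : (((realify X).det : ℝ) : ℂ) = ((realify X).map (Complex.ofRealHom : ℝ →+* ℂ)).det :=
    Complex.ofRealHom.map_det (realify X)
  have hX : (X.map Complex.re).map (Complex.ofRealHom : ℝ →+* ℂ) +
      Complex.I • (X.map Complex.im).map (Complex.ofRealHom : ℝ →+* ℂ) = X := by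
    ext i j
    simp [mul_comm Complex.I, Complex.re_add_im]
  have hX' : (X.map Complex.re).map (Complex.ofRealHom : ℝ →+* ℂ) -
      Complex.I • (X.map Complex.im).map (Complex.ofRealHom : ℝ →+* ℂ) =
      X.map (starRingEnd ℂ) := by
    ext i j
    apply Complex.ext <;> simp
  set R := (X.map Complex.re).map (Complex.ofRealHom : ℝ →+* ℂ)
  set J := (X.map Complex.im).map (Complex.ofRealHom : ℝ →+* ℂ)
  have h2 : (realify X).map (Complex.ofRealHom : ℝ →+* ℂ) = Matrix.fromBlocks R (-J) J R := by
    rw [realify, Matrix.fromBlocks_map]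
    congr 1
    ext i j
    simp [J]
  have h3 : Matrix.fromBlocks 1 (Complex.I • 1) 0 1 * Matrix.fromBlocks R (-J) J R *
      Matrix.fromBlocks 1 (-(Complex.I • 1)) 0 1 =
      Matrix.fromBlocks X 0 J (X.map (starRingEnd ℂ)) := by
    rw [Matrix.fromBlocks_multiply, Matrix.fromBlocks_multiply, ← hX', ← hX]
    congr 1
    · simp
    · simp only [Matrix.one_mul, Matrix.smul_mul, Matrix.mul_neg, Matrix.mul_smul, Matrix.mul_one,
        smul_add, smul_smul, Complex.I_mul_I]
      module
    · simp
    · simp [sub_eq_add_neg, add_comm]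
  have h4 := congrArg Matrix.det h3
  rw [Matrix.det_mul, Matrix.det_mul, Matrix.det_fromBlocks_zero₂₁, Matrix.det_fromBlocks_zero₂₁,
    Matrix.det_fromBlocks_zero₁₂] at h4
  simp only [Matrix.det_one, mul_one, one_mul] at h4
  have h5 : (X.map (starRingEnd ℂ)).det = (starRingEnd ℂ) X.det :=
    ((starRingEnd ℂ).map_det X).symm
  rw [h1, h2, h4, h5, Complex.mul_conj]

/-- A real nonpositive eigenvalue of `X` is an eigenvalue of its real form. -/
lemma det_add_ne_zero_of_eigenvaluesPos {X : Matrix (Fin n) (Fin n) ℂ}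
    (h : EigenvaluesPos (realify X)) {x : ℝ} (hx : 0 ≤ x) : ((x : ℂ) • 1 + X).det ≠ 0 := by
  intro hdet
  have h1 : (realify ((x : ℂ) • 1 + X)).det = 0 := by rw [det_realify, hdet, map_zero]
  rw [realify_add, realify_smul, realify_one] at h1
  have h2 : ((-x : ℝ) : ℂ) ∈ spectrum ℂ ((realify X).map (fun y : ℝ => (y : ℂ))) := by
    rw [spectrum.mem_iff, Matrix.isUnit_iff_isUnit_det, isUnit_iff_ne_zero, not_not]
    have h3 : algebraMap ℂ (Matrix (Fin n ⊕ Fin n) (Fin n ⊕ Fin n) ℂ) ((-x : ℝ) : ℂ) -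
        (realify X).map (fun y : ℝ => (y : ℂ)) =
        -((x • 1 + realify X).map (Complex.ofRealHom : ℝ →+* ℂ)) := by
      ext i j
      by_cases hij : i = j <;>
        simp [Matrix.algebraMap_matrix_apply, hij, sub_eq_add_neg, add_comm]
    have h4 : ((x • 1 + realify X).map (Complex.ofRealHom : ℝ →+* ℂ)).det = 0 := by
      have := Complex.ofRealHom.map_det (x • 1 + realify X)
      rw [h1, map_zero] at this
      exact this.symm
    rw [h3, Matrix.det_neg, h4, mul_zero]
  have := h _ h2
  simp at this
  linarith

end Realify

lemma matrixD_eq_realify {np nd K M : ℕ} (b : Pilots np K) (a : Codebooks nd K M)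
    (S : Finset (Fin K)) (w w' : Fin K → Fin M) (u r : ℝ) :
    matrixD b a S w w' u r =
      realify (chernoffMatrix (1 + errorCov b a w) (confusionCov b a S w w') u r) := by
  set X := confusionCov b a S w w'
  set T := errorCov b a w
  have h : chernoffMatrix (1 + T) X u r = ((1 + r : ℝ) : ℂ) • 1 + ((u * (1 - u + r) : ℝ) : ℂ) • X +
      (r : ℂ) • T + ((-(u * (u - r)) : ℝ) : ℂ) • (X * T) := by
    simp only [chernoffMatrix, Matrix.add_mul, Matrix.mul_add, Matrix.one_mul, Matrix.smul_mul,
      smul_add, smul_smul, Matrix.mul_one]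
    match_scalars <;> ring
  rw [h, realify_add, realify_add, realify_add, realify_smul, realify_smul, realify_smul,
    realify_smul, realify_one, realify_mul, matrixD, neg_smul, ← sub_eq_add_neg]

/-! ### Channel estimation -/

section Estimation

set_option linter.unusedSectionVars false

open Matrix

variable {p k n : Type} [Fintype p] [Fintype k] [Fintype n] [DecidableEq p] [DecidableEq k]
  [DecidableEq n]

lemma isUnit_det_one_add_conjTranspose_mul (B : Matrix p k ℂ) : IsUnit (1 + Bᴴ * B).det := by
  open scoped ComplexOrder in
  exact (Matrix.isUnit_iff_isUnit_det _).1
    (PosDef.one.add_posSemidef (posSemidef_conjTranspose_mul_self B)).isUnit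

/-- The estimation matrix `(I + Bᴴ B)⁻¹ Bᴴ`. -/
noncomputable def mmse (B : Matrix p k ℂ) : Matrix k p ℂ := (1 + Bᴴ * B)⁻¹ * Bᴴ

lemma isHermitian_inv_one_add (B : Matrix p k ℂ) : ((1 + Bᴴ * B)⁻¹)ᴴ = (1 + Bᴴ * B)⁻¹ := by
  rw [conjTranspose_nonsing_inv, conjTranspose_add, conjTranspose_one, conjTranspose_mul,
    conjTranspose_conjTranspose]

lemma mmse_mul (B : Matrix p k ℂ) : mmse B * B = 1 - (1 + Bᴴ * B)⁻¹ := by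
  have h := Matrix.nonsing_inv_mul _ (isUnit_det_one_add_conjTranspose_mul B)
  rw [Matrix.mul_add, Matrix.mul_one] at h
  rw [mmse, Matrix.mul_assoc, eq_sub_iff_add_eq, add_comm, h]

lemma mmse_mul_conjTranspose (B : Matrix p k ℂ) :
    mmse B * (mmse B)ᴴ = (1 - (1 + Bᴴ * B)⁻¹) * (1 + Bᴴ * B)⁻¹ := by
  rw [← mmse_mul]
  conv_lhs => rw [mmse, conjTranspose_mul, conjTranspose_conjTranspose, isHermitian_inv_one_add]
  rw [mmse]
  simp only [Matrix.mul_assoc]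

/-- The matrix that maps the stacked fading and noise arrays `(H, Z_p, Z_d)` to the residual
`A (H - Ĥ) + Z_d`. -/
noncomputable def residualMatrix (B : Matrix p k ℂ) (A : Matrix n k ℂ) :
    Matrix n (k ⊕ (p ⊕ n)) ℂ :=
  fromCols (A * (1 + Bᴴ * B)⁻¹) (fromCols (-(A * mmse B)) 1)

/-- The matrix that maps the stacked fading and noise arrays `(H, Z_p, Z_d)` to `E Ĥ`. -/
noncomputable def confusionMatrix (B : Matrix p k ℂ) (E : Matrix n k ℂ) :
    Matrix n (k ⊕ (p ⊕ n)) ℂ :=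
  fromCols (E * (1 - (1 + Bᴴ * B)⁻¹)) (fromCols (E * mmse B) 0)

lemma residualMatrix_mul_conjTranspose (B : Matrix p k ℂ) (A : Matrix n k ℂ) :
    residualMatrix B A * (residualMatrix B A)ᴴ = 1 + A * (1 + Bᴴ * B)⁻¹ * Aᴴ := by
  have h1 := mmse_mul_conjTranspose B
  have h2 := isHermitian_inv_one_add B
  rw [residualMatrix, conjTranspose_fromCols_eq_fromRows_conjTranspose, fromCols_mul_fromRows,
    conjTranspose_fromCols_eq_fromRows_conjTranspose, fromCols_mul_fromRows, conjTranspose_one,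
    Matrix.one_mul]
  set T := (1 + Bᴴ * B)⁻¹
  set C := mmse B
  have e : A * T * (A * T)ᴴ + -(A * C) * (-(A * C))ᴴ = A * (T * Tᴴ + C * Cᴴ) * Aᴴ := by
    simp only [conjTranspose_mul, conjTranspose_neg, Matrix.mul_add, Matrix.add_mul,
      Matrix.mul_assoc, Matrix.neg_mul, Matrix.mul_neg, neg_neg]
  rw [← add_assoc, e, h1, h2, Matrix.sub_mul, Matrix.one_mul, add_sub_cancel, add_comm]

lemma confusionMatrix_mul_conjTranspose (B : Matrix p k ℂ) (E : Matrix n k ℂ) :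
    confusionMatrix B E * (confusionMatrix B E)ᴴ = E * (1 - (1 + Bᴴ * B)⁻¹) * Eᴴ := by
  have h1 := mmse_mul_conjTranspose B
  have h2 := isHermitian_inv_one_add B
  rw [confusionMatrix, conjTranspose_fromCols_eq_fromRows_conjTranspose, fromCols_mul_fromRows,
    conjTranspose_fromCols_eq_fromRows_conjTranspose, fromCols_mul_fromRows, Matrix.zero_mul,
    add_zero]
  set T := (1 + Bᴴ * B)⁻¹
  set C := mmse B
  have e : E * (1 - T) * (E * (1 - T))ᴴ + E * C * (E * C)ᴴ =
      E * ((1 - T) * (1 - T)ᴴ + C * Cᴴ) * Eᴴ := by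
    simp only [conjTranspose_mul, Matrix.mul_add, Matrix.add_mul, Matrix.mul_assoc]
  have e2 : (1 - T) * (1 - T) + (1 - T) * T = 1 - T := by
    rw [← Matrix.mul_add, sub_add_cancel, Matrix.mul_one]
  rw [e, h1, conjTranspose_sub, conjTranspose_one, h2, e2]

/-- The estimation error is uncorrelated with the estimate. -/
lemma residualMatrix_mul_confusionMatrix (B : Matrix p k ℂ) (A E : Matrix n k ℂ) :
    residualMatrix B A * (confusionMatrix B E)ᴴ = 0 := by
  have h1 := mmse_mul_conjTranspose B
  have h2 := isHermitian_inv_one_add B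
  rw [residualMatrix, confusionMatrix, conjTranspose_fromCols_eq_fromRows_conjTranspose,
    fromCols_mul_fromRows, conjTranspose_fromCols_eq_fromRows_conjTranspose, fromCols_mul_fromRows,
    conjTranspose_zero, Matrix.mul_zero, add_zero]
  set T := (1 + Bᴴ * B)⁻¹
  set C := mmse B
  have e (V : Matrix k k ℂ) :
      A * T * (E * V)ᴴ + -(A * C) * (E * C)ᴴ = A * (T * Vᴴ - C * Cᴴ) * Eᴴ := by
    simp only [conjTranspose_mul, Matrix.mul_sub, Matrix.sub_mul, Matrix.mul_assoc, Matrix.neg_mul,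
      ← sub_eq_add_neg]
  have e2 : T * (1 - T) - (1 - T) * T = 0 := by
    rw [Matrix.mul_sub, Matrix.sub_mul, Matrix.mul_one, Matrix.one_mul, sub_self]
  rw [e, h1, conjTranspose_sub, conjTranspose_one, h2, e2, Matrix.mul_zero, Matrix.zero_mul]

/-- The joint covariance of the residual and of `E Ĥ` is block diagonal. -/
lemma covariance_residual_confusion (B : Matrix p k ℂ) (A E : Matrix n k ℂ) :
    fromRows (residualMatrix B A) (confusionMatrix B E) *
      (fromRows (residualMatrix B A) (confusionMatrix B E))ᴴ =
    fromBlocks (1 + A * (1 + Bᴴ * B)⁻¹ * Aᴴ) 0 0 (E * (1 - (1 + Bᴴ * B)⁻¹) * Eᴴ) := by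
  rw [conjTranspose_fromRows_eq_fromCols_conjTranspose, fromRows_mul_fromCols,
    residualMatrix_mul_conjTranspose, confusionMatrix_mul_conjTranspose,
    residualMatrix_mul_confusionMatrix]
  congr 1
  have := congrArg conjTranspose (residualMatrix_mul_confusionMatrix B A E)
  rwa [conjTranspose_mul, conjTranspose_conjTranspose, conjTranspose_zero] at this

end Estimation

/-! ### Tails of correlated Gaussian arrays -/

section Tails

set_option linter.unusedSectionVars false

open scoped ComplexOrder
open Matrix

variable {m : Type} [Fintype m] [DecidableEq m] {n L : ℕ}

lemma bddAbove_spectrum {Θ : Matrix (Fin n) (Fin n) ℂ} (hΘ : Θ.IsHermitian) :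
    BddAbove (spectrum ℝ Θ) := by
  rw [hΘ.spectrum_real_eq_range_eigenvalues]
  exact (Set.finite_range _).bddAbove

lemma eigenvalues_le_lambdaMax {Θ : Matrix (Fin n) (Fin n) ℂ} (hΘ : Θ.IsHermitian) (i : Fin n) :
    hΘ.eigenvalues i ≤ lambdaMax Θ :=
  le_csSup (bddAbove_spectrum hΘ) (by
    rw [hΘ.spectrum_real_eq_range_eigenvalues]; exact ⟨i, rfl⟩)

/-- The energy of a Gaussian array with covariance `I + Θ` is distributed as the energy of a
standard array whose rows are weighted by the eigenvalues of `I + Θ`. -/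
lemma gaussianArray_energy_linImage {Θ : Matrix (Fin n) (Fin n) ℂ} (hΘ : Θ.PosSemidef)
    (P : Matrix (Fin n) m ℂ) (hP : P * Pᴴ = 1 + Θ) (τ : ℝ) :
    gaussianArray m (Fin L) 1 {Z | τ < energy (linImage P Z)} =
      gaussianArray (Fin n) (Fin L) 1
        {Z | τ < ∑ i, (1 + hΘ.1.eigenvalues i) * ∑ k, ‖Z i k‖ ^ 2} := by
  obtain ⟨U, hU1, hU2, hU⟩ := exists_unitary_diagonal hΘ.1
  set d := hΘ.1.eigenvalues
  have hd : ∀ i, 0 ≤ 1 + d i := fun i => by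
    have : 0 ≤ d i := hΘ.eigenvalues_nonneg i
    linarith
  set S : Matrix (Fin n) (Fin n) ℂ := diagonal fun i => ((√(1 + d i) : ℝ) : ℂ) with hS
  have hSH : Sᴴ = S := by
    rw [hS, diagonal_conjTranspose]
    congr 1
    funext i
    simp
  have hSS : S * S = diagonal fun i => ((1 + d i : ℝ) : ℂ) := by
    rw [hS, diagonal_mul_diagonal]
    congr 1
    funext i
    rw [← Complex.ofReal_mul, Real.mul_self_sqrt (hd i)]
  have hcov : P * Pᴴ = (U * S) * (U * S)ᴴ := by
    have h1 : (diagonal fun i => ((1 + d i : ℝ) : ℂ)) = 1 + diagonal fun i => (d i : ℂ) := by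
      rw [← diagonal_one, diagonal_add]
      push_cast; rfl
    rw [hP, conjTranspose_mul, hSH, Matrix.mul_assoc, ← Matrix.mul_assoc S, hSS, h1,
      Matrix.add_mul, Matrix.mul_add, Matrix.one_mul, hU2, ← Matrix.mul_assoc, ← hU]
  have hset : ∀ {ι : Type} [Fintype ι] (Q : Matrix (Fin n) ι ℂ),
      gaussianArray ι (Fin L) 1 {Z | τ < energy (linImage Q Z)} =
      (gaussianArray ι (Fin L) 1).map (linImage Q) {Z | τ < energy Z} := fun Q => by
    rw [Measure.map_apply (measurable_linImage Q)]
    · rfl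
    · exact measurableSet_lt measurable_const continuous_energy.measurable
  rw [hset P, map_linImage_eq P (U * S) hcov, ← hset (U * S)]
  congr 1
  ext Z
  rw [Set.mem_ofPred_eq, Set.mem_ofPred_eq, ← pairing_self, pairing_linImage, linImage_linImage,
    conjTranspose_mul, hSH]
  have h2 : S * Uᴴ * U * S = diagonal fun i => ((1 + d i : ℝ) : ℂ) := by
    rw [Matrix.mul_assoc S, hU1, Matrix.mul_one, hSS]
  have h3 : pairing (linImage (S * Uᴴ * (U * S)) Z) Z =
      pairing Z (linImage (diagonal fun i => ((1 + d i : ℝ) : ℂ)) Z) := by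
    rw [← Matrix.mul_assoc, h2, pairing_linImage, diagonal_conjTranspose]
    congr 3
    funext i
    simp
  rw [h3, pairing_diagonal]

lemma measure_le_lintegral_exp {α : Type} [MeasurableSpace α] (μ : Measure α) {s : Set α}
    (hs : MeasurableSet s) (f : α → ℝ) (hf : ∀ x ∈ s, 0 ≤ f x) :
    μ s ≤ ∫⁻ x, ENNReal.ofReal (Real.exp (f x)) ∂μ := by
  rw [← lintegral_indicator_one hs]
  refine lintegral_mono fun x => ?_
  by_cases hx : x ∈ s
  · rw [Set.indicator_of_mem hx, Pi.one_apply, ENNReal.one_le_ofReal]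
    exact Real.one_le_exp (hf x hx)
  · rw [Set.indicator_of_notMem hx]
    exact zero_le

/-- Chernoff's bound for the energy of a Gaussian array with covariance `I + Θ`. -/
theorem gaussianArray_energy_le_chernoff {Θ : Matrix (Fin n) (Fin n) ℂ} (hΘ : Θ.PosSemidef)
    (P : Matrix (Fin n) m ℂ) (hP : P * Pᴴ = 1 + Θ) (τ : ℝ) {δ : ℝ} (hδ : 0 ≤ δ)
    (hδ' : δ < 1 / (1 + lambdaMax Θ)) :
    gaussianArray m (Fin L) 1 {Z | τ < energy (linImage P Z)} ≤
      ENNReal.ofReal (Real.exp (-(δ * τ)) *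
        ((((1 - (δ : ℂ)) • (1 : Matrix (Fin n) (Fin n) ℂ) - (δ : ℂ) • Θ).det).re ^ L)⁻¹) := by
  rw [gaussianArray_energy_linImage hΘ P hP]
  obtain ⟨U, hU1, hU2, hU⟩ := exists_unitary_diagonal hΘ.1
  set d := hΘ.1.eigenvalues with hd
  have hd0 : ∀ i, 0 ≤ d i := fun i => hΘ.eigenvalues_nonneg i
  have hc : ∀ i, 0 < 1 + -(δ * (1 + d i)) := fun i => by
    have h1 : d i ≤ lambdaMax Θ := eigenvalues_le_lambdaMax hΘ.1 i
    have h2 : 0 < 1 + lambdaMax Θ := by linarith [hd0 i]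
    rw [lt_div_iff₀ h2] at hδ'
    nlinarith
  have hdet : ((1 - (δ : ℂ)) • (1 : Matrix (Fin n) (Fin n) ℂ) - (δ : ℂ) • Θ).det =
      ((∏ i, (1 + -(δ * (1 + d i))) : ℝ) : ℂ) := by
    have h1 : (1 - (δ : ℂ)) • (1 : Matrix (Fin n) (Fin n) ℂ) - (δ : ℂ) • Θ =
        U * (diagonal fun i => ((1 + -(δ * (1 + d i)) : ℝ) : ℂ)) * Uᴴ := by
      have h2 : (diagonal fun i => ((1 + -(δ * (1 + d i)) : ℝ) : ℂ)) =
          (1 - (δ : ℂ)) • 1 - (δ : ℂ) • diagonal fun i => (d i : ℂ) := by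
        ext i j
        rcases eq_or_ne i j with rfl | h
        · simp
          ring
        · simp [h]
      rw [h2, Matrix.mul_sub, Matrix.sub_mul, Matrix.mul_smul, Matrix.mul_one, Matrix.smul_mul,
        Matrix.mul_smul, Matrix.smul_mul, hU2, ← hU]
    rw [h1, det_mul, det_mul, mul_right_comm, ← det_mul, hU2, det_one, one_mul, det_diagonal]
    push_cast; rfl
  have hmeas : MeasurableSet
      {Z : Fin n → Fin L → ℂ | τ < ∑ i, (1 + d i) * ∑ k, ‖Z i k‖ ^ 2} :=
    measurableSet_lt measurable_const (by fun_prop)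
  calc _ ≤ ∫⁻ Z : Fin n → Fin L → ℂ, ENNReal.ofReal (Real.exp
        (δ * (∑ i, (1 + d i) * ∑ k, ‖Z i k‖ ^ 2 - τ))) ∂(gaussianArray (Fin n) (Fin L) 1) :=
        measure_le_lintegral_exp _ hmeas _ fun Z hZ => mul_nonneg hδ (sub_pos.2 hZ).le
    _ = ∫⁻ Z : Fin n → Fin L → ℂ, ENNReal.ofReal (Real.exp (-(δ * τ))) * ENNReal.ofReal (Real.exp
        (-∑ i, -(δ * (1 + d i)) * ∑ k, ‖Z i k‖ ^ 2)) ∂(gaussianArray (Fin n) (Fin L) 1) := by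
        refine lintegral_congr fun Z => ?_
        rw [← ENNReal.ofReal_mul (Real.exp_pos _).le, ← Real.exp_add]
        congr 2
        rw [← Finset.sum_neg_distrib, mul_sub, Finset.mul_sum, sub_eq_neg_add]
        congr 1
        refine Finset.sum_congr rfl fun i _ => ?_
        ring
    _ = _ := by
        rw [lintegral_const_mul' _ _ ENNReal.ofReal_ne_top, lintegral_exp_weighted_energy _ hc,
          hdet, Complex.ofReal_re, ← ENNReal.ofReal_mul (Real.exp_pos _).le, Fintype.card_fin,
          inv_pow]

lemma lowerGamma_zero (s : ℝ) : lowerGamma s 0 = 0 := by simp [lowerGamma]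

/-- The energy of some rows of a standard Gaussian array. -/
lemma gaussianArray_rows_energy_gt (I : Finset (Fin n)) (hI : I.Nonempty) (hL : 1 ≤ L) {N : ℝ}
    (hN : N = L * I.card) (x : ℝ) :
    gaussianArray (Fin n) (Fin L) 1 {Z | x < ∑ i ∈ I, ∑ k, ‖Z i k‖ ^ 2} =
      ENNReal.ofReal (1 - lowerGamma N x / Real.Gamma N) := by
  have : Nonempty I := hI.to_subtype
  have : Nonempty (Fin L) := ⟨⟨0, hL⟩⟩
  have hN' : N = Fintype.card I * Fintype.card (Fin L) := by
    rw [hN, Fintype.card_coe, Fintype.card_fin, mul_comm]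
  rw [← gaussianArray_energy_gt (ι := I) (κ := Fin L) hN' x]
  set Q : Matrix I (Fin n) ℂ := (1 : Matrix (Fin n) (Fin n) ℂ).submatrix Subtype.val id with hQ
  have hQQ : Q * Qᴴ = (1 : Matrix I I ℂ) * (1 : Matrix I I ℂ)ᴴ := by
    rw [hQ, conjTranspose_submatrix, conjTranspose_one,
      ← Matrix.submatrix_mul _ _ _ _ _ Function.bijective_id, Matrix.one_mul,
      submatrix_one _ Subtype.val_injective, conjTranspose_one, Matrix.one_mul]
  have hid : (linImage (1 : Matrix I I ℂ) : (I → Fin L → ℂ) → _) = id :=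
    funext fun Z => linImage_one Z
  have hmap := map_linImage_eq (κ := Fin L) Q (1 : Matrix I I ℂ) hQQ
  rw [hid, Measure.map_id] at hmap
  rw [← hmap, Measure.map_apply (measurable_linImage Q)
    (measurableSet_lt measurable_const continuous_energy.measurable)]
  congr 1
  ext Z
  have h : linImage Q Z = fun (i : I) k => Z i k := by
    funext i k
    simp [linImage, hQ, Matrix.one_apply]
  simp only [Set.mem_ofPred_eq, Set.mem_preimage, h, energy]
  rw [Finset.sum_coe_sort I (fun i => ∑ k, ‖Z i k‖ ^ 2)]

/-- The tail bound obtained by separating the part of the covariance that exceeds the identity,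
which has rank at most `N`. -/
theorem gaussianArray_energy_le_gamma {Θ : Matrix (Fin n) (Fin n) ℂ} (hΘ : Θ.PosSemidef)
    (P : Matrix (Fin n) m ℂ) (hP : P * Pᴴ = 1 + Θ) (hL : 1 ≤ L) (hn : 1 ≤ n) {N : ℕ} (hN1 : 1 ≤ N)
    (hNn : N ≤ n) (hrank : Θ.rank ≤ N) (τ₁ τ₂ : ℝ) :
    gaussianArray m (Fin L) 1 {Z | τ₁ + τ₂ < energy (linImage P Z)} ≤
      ENNReal.ofReal (2 - lowerGamma (n * L) τ₁ / Real.Gamma (n * L) -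
        lowerGamma (L * N) (τ₂ / lambdaMax Θ) / Real.Gamma (L * N)) := by
  have hnL : (0 : ℝ) < n * L := by positivity
  have hLN : (0 : ℝ) < L * N := by positivity
  have hsplit : ENNReal.ofReal (2 - lowerGamma (n * L) τ₁ / Real.Gamma (n * L) -
        lowerGamma (L * N) (τ₂ / lambdaMax Θ) / Real.Gamma (L * N)) =
      ENNReal.ofReal (1 - lowerGamma (n * L) τ₁ / Real.Gamma (n * L)) +
      ENNReal.ofReal (1 - lowerGamma (L * N) (τ₂ / lambdaMax Θ) / Real.Gamma (L * N)) := by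
    rw [← ENNReal.ofReal_add (sub_nonneg.2 (lowerGamma_div_Gamma_le_one hnL _))
      (sub_nonneg.2 (lowerGamma_div_Gamma_le_one hLN _))]
    congr 1
    ring
  rw [hsplit, gaussianArray_energy_linImage hΘ P hP]
  have hle : ∀ i, hΘ.1.eigenvalues i ≤ lambdaMax Θ := eigenvalues_le_lambdaMax hΘ.1
  have hlam : 0 ≤ lambdaMax Θ := (hΘ.eigenvalues_nonneg ⟨0, hn⟩).trans (hle _)
  set d := hΘ.1.eigenvalues with hd
  rcases eq_or_lt_of_le hlam with h0 | hpos
  · -- Here the second summand is `1`, since the division by `λ_max = 0` gives `0`.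
    rw [← h0, div_zero, lowerGamma_zero, zero_div, sub_zero, ENNReal.ofReal_one]
    exact prob_le_one.trans le_add_self
  have hcard : (Finset.univ.filter fun i => d i ≠ 0).card ≤ N := by
    rw [hΘ.1.rank_eq_card_non_zero_eigs, Fintype.card_subtype] at hrank
    exact hrank
  obtain ⟨I, hI1, -, hI2⟩ := Finset.exists_subsuperset_card_eq
    (Finset.subset_univ (Finset.univ.filter fun i => d i ≠ 0)) hcard (by simpa using hNn)
  have hsub : {Z : Fin n → Fin L → ℂ | τ₁ + τ₂ < ∑ i, (1 + d i) * ∑ k, ‖Z i k‖ ^ 2} ⊆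
      {Z | τ₁ < energy Z} ∪ {Z | τ₂ / lambdaMax Θ < ∑ i ∈ I, ∑ k, ‖Z i k‖ ^ 2} := by
    intro Z hZ
    by_contra hcon
    simp only [Set.mem_union, Set.mem_ofPred_eq, not_or, not_lt] at hcon hZ
    obtain ⟨h1, h2⟩ := hcon
    rw [le_div_iff₀ hpos] at h2
    have h3 : ∑ i, (1 + d i) * ∑ k, ‖Z i k‖ ^ 2 =
        energy Z + ∑ i ∈ I, d i * ∑ k, ‖Z i k‖ ^ 2 := by
      simp only [add_mul, one_mul, Finset.sum_add_distrib, energy]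
      congr 1
      symm
      refine Finset.sum_subset (Finset.subset_univ I) fun i _ hi => ?_
      have : d i = 0 := by
        by_contra h
        exact hi (hI1 (by simpa using h))
      rw [this, zero_mul]
    have h4 : ∑ i ∈ I, d i * ∑ k, ‖Z i k‖ ^ 2 ≤ (∑ i ∈ I, ∑ k, ‖Z i k‖ ^ 2) * lambdaMax Θ := by
      rw [Finset.sum_mul]
      refine Finset.sum_le_sum fun i _ => ?_
      rw [mul_comm]
      exact mul_le_mul_of_nonneg_left (hle i) (by positivity)
    linarith
  have : Nonempty (Fin L) := ⟨⟨0, hL⟩⟩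
  have : Nonempty (Fin n) := ⟨⟨0, hn⟩⟩
  refine (measure_mono hsub).trans ((measure_union_le _ _).trans ?_)
  rw [gaussianArray_energy_gt (N := n * L) (by simp), gaussianArray_rows_energy_gt I
    (Finset.card_pos.1 (by omega)) hL (N := L * N) (by rw [hI2])]

/-- The Chernoff bound for the event that the residual `g` has energy at most `τ` and is not
closer to zero than `g + v`, where `g` and `v` are uncorrelated. -/
theorem gaussianArray_confusion_le (C X : Matrix (Fin n) (Fin n) ℂ) (P₁ P₂ : Matrix (Fin n) m ℂ)
    (hP : fromRows P₁ P₂ * (fromRows P₁ P₂)ᴴ = fromBlocks C 0 0 X) {u r : ℝ} (hu : 0 ≤ u)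
    (hr : 0 ≤ r) (hD : EigenvaluesPos (realify (chernoffMatrix C X u r))) (τ : ℝ) :
    gaussianArray m (Fin L) 1 {Z | energy (linImage P₁ Z + linImage P₂ Z) ≤ energy (linImage P₁ Z) ∧
        energy (linImage P₁ Z) ≤ τ} ≤
      ENNReal.ofReal (Real.exp (r * τ - (L : ℝ) / 2 *
        Real.log (realify (chernoffMatrix C X u r)).det)) := by
  have hpd := posDef_one_add_chernoffForm C X hu hr (fromRows P₁ P₂) hP
    (fun x hx => det_add_ne_zero_of_eigenvaluesPos hD hx)
  have hdet := det_one_add_chernoffForm C X u r (fromRows P₁ P₂) hP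
  set R := (fromRows P₁ P₂)ᴴ * chernoffForm (Fin n) u r * fromRows P₁ P₂ with hR
  have hform : ∀ Z : m → Fin L → ℂ, pairing Z (linImage R Z) =
      r * energy (linImage P₁ Z) + u * (energy (linImage P₁ Z + linImage P₂ Z) -
        energy (linImage P₁ Z)) := by
    intro Z
    have h1 : linImage (chernoffForm (Fin n) u r * fromRows P₁ P₂) Z =
        Sum.elim (fun i k => (r : ℂ) * linImage P₁ Z i k + u * linImage P₂ Z i k)
          (fun i k => (u : ℂ) * linImage P₁ Z i k + u * linImage P₂ Z i k) := by
      rw [chernoffForm, fromBlocks_mul_fromRows]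
      funext i k
      rcases i with i | i <;>
        simp [linImage, Finset.mul_sum, ← Finset.sum_add_distrib, add_mul, mul_assoc]
    have h2 : linImage (fromRows P₁ P₂) Z = Sum.elim (linImage P₁ Z) (linImage P₂ Z) := by
      funext i k
      rcases i with i | i <;> rfl
    have h3 := pairing_linImage (fromRows P₁ P₂)ᴴ Z
      (linImage (chernoffForm (Fin n) u r * fromRows P₁ P₂) Z)
    rw [linImage_linImage, conjTranspose_conjTranspose, ← Matrix.mul_assoc, ← hR, h1, h2] at h3
    rw [h3]
    simp only [pairing, energy, Fintype.sum_sum_type, Sum.elim_inl, Sum.elim_inr, Finset.mul_sum,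
      ← Finset.sum_add_distrib, ← Finset.sum_sub_distrib]
    refine Finset.sum_congr rfl fun i _ => Finset.sum_congr rfl fun k _ => ?_
    simp only [Complex.sq_norm, Complex.normSq_apply, Pi.add_apply, Complex.mul_re, Complex.mul_im,
      Complex.add_re, Complex.add_im, Complex.conj_re, Complex.conj_im, Complex.ofReal_re,
      Complex.ofReal_im]
    ring
  have hpos : 0 < (1 + R).det := hpd.det_pos
  rw [hdet] at hpos
  set Dm := chernoffMatrix C X u r
  have hre : 0 < Dm.det.re := (Complex.pos_iff.1 hpos).1
  have him : Dm.det.im = 0 := (Complex.pos_iff.1 hpos).2.symm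
  have hlog : Real.exp (r * τ - (L : ℝ) / 2 * Real.log (realify Dm).det) =
      Real.exp (r * τ) * (Dm.det.re)⁻¹ ^ L := by
    have h1 : (realify Dm).det = Dm.det.re ^ 2 := by
      rw [det_realify, Complex.normSq_apply, him]; ring
    rw [h1, Real.log_pow, sub_eq_add_neg, Real.exp_add]
    congr 1
    rw [show -((L : ℝ) / 2 * (((2 : ℕ) : ℝ) * Real.log Dm.det.re)) =
      (L : ℝ) * -Real.log Dm.det.re by push_cast; ring, Real.exp_nat_mul, Real.exp_neg,
      Real.exp_log hre]
  have hc1 : Continuous fun Z : m → Fin L → ℂ => energy (linImage P₁ Z) :=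
    continuous_energy.comp (continuous_linImage P₁)
  have hc2 : Continuous fun Z : m → Fin L → ℂ => energy (linImage P₁ Z + linImage P₂ Z) :=
    continuous_energy.comp ((continuous_linImage P₁).add (continuous_linImage P₂))
  have hmeas : MeasurableSet {Z : m → Fin L → ℂ | energy (linImage P₁ Z + linImage P₂ Z) ≤
      energy (linImage P₁ Z) ∧ energy (linImage P₁ Z) ≤ τ} :=
    (measurableSet_le hc2.measurable hc1.measurable).inter
      (measurableSet_le hc1.measurable measurable_const)
  rw [hlog]
  calc _ ≤ ∫⁻ Z : m → Fin L → ℂ, ENNReal.ofReal (Real.exp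
        (r * τ + -pairing Z (linImage R Z))) ∂(gaussianArray m (Fin L) 1) := by
        refine measure_le_lintegral_exp _ hmeas _ fun Z hZ => ?_
        rw [hform]
        nlinarith [mul_nonneg hr (sub_nonneg.2 hZ.2), mul_nonneg hu (sub_nonneg.2 hZ.1)]
    _ = ENNReal.ofReal (Real.exp (r * τ)) * ∫⁻ Z : m → Fin L → ℂ, ENNReal.ofReal (Real.exp
        (-pairing Z (linImage R Z))) ∂(gaussianArray m (Fin L) 1) := by
        rw [← lintegral_const_mul' _ _ ENNReal.ofReal_ne_top]
        refine lintegral_congr fun Z => ?_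
        rw [← ENNReal.ofReal_mul (Real.exp_pos _).le, ← Real.exp_add]
    _ = _ := by
        rw [lintegral_exp_neg_quadraticForm hpd, hdet, ← ENNReal.ofReal_mul (Real.exp_pos _).le,
          Fintype.card_fin]

end Tails

/-! ### The decoding metric given pilots, codebooks and messages -/

section Metric

open Matrix

variable {np nd K M L : ℕ}

/-- Fading, pilot noise and data noise. -/
abbrev Noise (np nd K L : ℕ) : Type :=
  (Fin K → Fin L → ℂ) × (Fin np → Fin L → ℂ) × (Fin nd → Fin L → ℂ)

/-- The law of fading and noise. -/
noncomputable def noiseLaw (np nd K L : ℕ) : Measure (Noise np nd K L) :=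
  (gaussianArray (Fin K) (Fin L) 1).prod <|
    (gaussianArray (Fin np) (Fin L) 1).prod (gaussianArray (Fin nd) (Fin L) 1)

instance : IsProbabilityMeasure (noiseLaw np nd K L) := by
  unfold noiseLaw; infer_instance

/-- Fading and noise as one array. -/
def stack (z : Noise np nd K L) : Fin K ⊕ (Fin np ⊕ Fin nd) → Fin L → ℂ :=
  Sum.elim z.1 (Sum.elim z.2.1 z.2.2)

lemma measurePreserving_sumElim {ι ι' κ : Type} [Fintype ι] [Fintype ι'] [Fintype κ] (v : ℝ≥0) :
    MeasurePreserving (fun p : (ι → κ → ℂ) × (ι' → κ → ℂ) => Sum.elim p.1 p.2)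
      ((gaussianArray ι κ v).prod (gaussianArray ι' κ v)) (gaussianArray (ι ⊕ ι') κ v) := by
  have h := measurePreserving_sumPiEquivProdPi_symm (X := fun _ : ι ⊕ ι' => κ → ℂ)
    (fun _ => Measure.pi fun _ => complexGaussian v)
  have he : (fun p : (ι → κ → ℂ) × (ι' → κ → ℂ) => (Sum.elim p.1 p.2 : ι ⊕ ι' → κ → ℂ)) =
      (MeasurableEquiv.sumPiEquivProdPi fun _ : ι ⊕ ι' => κ → ℂ).symm := by
    funext p i
    rcases i with i | i <;> rfl
  rw [he]
  exact h

lemma measurePreserving_stack : MeasurePreserving (stack (np := np) (nd := nd) (K := K) (L := L))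
    (noiseLaw np nd K L) (gaussianArray (Fin K ⊕ (Fin np ⊕ Fin nd)) (Fin L) 1) :=
  (measurePreserving_sumElim 1).comp ((MeasurePreserving.id _).prod (measurePreserving_sumElim 1))

/-- The observation when no codeword is replaced by zero. -/
noncomputable def cleanObservation (b : Pilots np K) (a : Codebooks nd K M) (w : Fin K → Fin M)
    (z : Noise np nd K L) : Observation np nd K M L :=
  (b, a, pilotMatrix b * (Matrix.of z.1 : Matrix (Fin K) (Fin L) ℂ) + Matrix.of z.2.1,
    selected a Finset.univ w * (Matrix.of z.1 : Matrix (Fin K) (Fin L) ℂ) + Matrix.of z.2.2)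

lemma selected_apply (a : Codebooks nd K M) (S : Finset (Fin K)) (w : Fin K → Fin M) (i : Fin nd)
    (k : Fin K) : selected a S w i k = if k ∈ S then a i (k, w k) else 0 := by
  rw [selected, Matrix.mul_apply]
  by_cases h : k ∈ S <;> simp [selection, codebookMatrix, h]

lemma transmitted_eq_selected {E : ℝ} {a : Codebooks nd K M} {w : Fin K → Fin M}
    (h : ∀ k, ∑ j, ‖a j (k, w k)‖ ^ 2 ≤ E) : transmitted E a w = selected a Finset.univ w := by
  ext i k
  rw [selected_apply, transmitted, Matrix.of_apply, if_pos (h k), if_pos (Finset.mem_univ k)]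

/-- Up to the law of the stacked Gaussian array, the metric of `v`, when `w` is sent, is the energy
of the residual plus the difference of the codewords times the channel estimate. -/
lemma metric_cleanObservation (b : Pilots np K) (a : Codebooks nd K M) (w v : Fin K → Fin M)
    (z : Noise np nd K L) :
    metric (cleanObservation b a w z) v =
      energy (linImage (residualMatrix (pilotMatrix b) (selected a Finset.univ w)) (stack z) +
        linImage (confusionMatrix (pilotMatrix b)
          (selected a Finset.univ w - selected a Finset.univ v)) (stack z)) := by
  have hstack : ∀ (X : Matrix (Fin nd) (Fin K) ℂ) (Y : Matrix (Fin nd) (Fin np) ℂ)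
      (W : Matrix (Fin nd) (Fin nd) ℂ), (Matrix.of (linImage (fromCols X (fromCols Y W)) (stack z)) :
        Matrix (Fin nd) (Fin L) ℂ) = X * Matrix.of z.1 + (Y * Matrix.of z.2.1 + W * Matrix.of z.2.2)
      := by
    intro X Y W
    ext i k
    simp [linImage, stack, Matrix.mul_apply, Fintype.sum_sum_type]
  have hfrob : ∀ X : Fin nd → Fin L → ℂ, energy X = frobSq (Matrix.of X) := fun X => rfl
  rw [hfrob, metric, ← Matrix.of_add_of]
  congr 1
  rw [residualMatrix, confusionMatrix, hstack, hstack]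
  simp only [cleanObservation, channelEstimate]
  have h := mmse_mul (pilotMatrix b)
  change Matrix.of (_ + _) - _ * (mmse (pilotMatrix b) * Matrix.of (_ + _)) = _
  set A := selected a Finset.univ w
  set A' := selected a Finset.univ v
  set C := mmse (pilotMatrix b)
  set T := (1 + (pilotMatrix b)ᴴ * pilotMatrix b)⁻¹
  set H : Matrix (Fin K) (Fin L) ℂ := Matrix.of z.1
  set Zp : Matrix (Fin np) (Fin L) ℂ := Matrix.of z.2.1
  set Zd : Matrix (Fin nd) (Fin L) ℂ := Matrix.of z.2.2
  change (A * H + Zd) - A' * (C * (pilotMatrix b * H + Zp)) = _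
  rw [Matrix.mul_add, ← Matrix.mul_assoc C, h]
  simp only [Matrix.mul_add, Matrix.mul_sub, Matrix.sub_mul, Matrix.mul_one,
    Matrix.one_mul, Matrix.mul_assoc, Matrix.neg_mul, Matrix.zero_mul]
  abel

lemma metric_cleanObservation_self (b : Pilots np K) (a : Codebooks nd K M) (w : Fin K → Fin M)
    (z : Noise np nd K L) :
    metric (cleanObservation b a w z) w =
      energy (linImage (residualMatrix (pilotMatrix b) (selected a Finset.univ w)) (stack z)) := by
  rw [metric_cleanObservation, sub_self]
  congr 1
  have : confusionMatrix (pilotMatrix b) (0 : Matrix (Fin nd) (Fin K) ℂ) = 0 := by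
    simp [confusionMatrix]
  rw [this]
  funext i k
  simp [linImage]

section Continuity

lemma continuous_inv_one_add {α p k : Type} [TopologicalSpace α] [Fintype p] [Fintype k]
    [DecidableEq p] [DecidableEq k] {B : α → Matrix p k ℂ} (hB : Continuous B) :
    Continuous fun x => (1 + (B x)ᴴ * B x)⁻¹ := by
  have hc : Continuous fun x => 1 + (B x)ᴴ * B x :=
    continuous_const.add (hB.matrix_conjTranspose.matrix_mul hB)
  simp_rw [Matrix.inv_def, Ring.inverse_eq_inv']
  exact (hc.matrix_det.inv₀ fun x =>
    (isUnit_det_one_add_conjTranspose_mul (B x)).ne_zero).smul hc.matrix_adjugate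

lemma continuous_pilotMatrix :
    Continuous (pilotMatrix : Pilots np K → Matrix (Fin np) (Fin K) ℂ) := by
  refine continuous_matrix fun i k => ?_
  simp only [pilotMatrix, Matrix.of_apply]
  fun_prop

lemma continuous_selected (S : Finset (Fin K)) (w : Fin K → Fin M) :
    Continuous fun a : Codebooks nd K M => selected a S w := by
  refine continuous_matrix fun i k => ?_
  simp only [selected_apply]
  split_ifs <;> fun_prop

lemma continuous_metric (w : Fin K → Fin M) :
    Continuous fun o : Observation np nd K M L => metric o w := by
  have h1 : Continuous fun o : Observation np nd K M L => pilotMatrix o.1 :=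
    continuous_pilotMatrix.comp continuous_fst
  have h2 : Continuous fun o : Observation np nd K M L => channelEstimate (pilotMatrix o.1)
      (Matrix.of o.2.2.1) :=
    ((continuous_inv_one_add h1).matrix_mul h1.matrix_conjTranspose).matrix_mul
      (continuous_fst.comp (continuous_snd.comp continuous_snd))
  have h3 : Continuous fun o : Observation np nd K M L => Matrix.of o.2.2.2 -
      selected o.2.1 Finset.univ w * channelEstimate (pilotMatrix o.1) (Matrix.of o.2.2.1) :=
    Continuous.sub (continuous_snd.comp (continuous_snd.comp continuous_snd))
      (((continuous_selected _ w).comp (continuous_fst.comp continuous_snd)).matrix_mul h2)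
  unfold metric frobSq
  refine continuous_finsetSum _ fun i _ => continuous_finsetSum _ fun j _ => ?_
  exact (h3.matrix_elem i j).norm.pow 2

lemma continuous_cleanObservation (w : Fin K → Fin M) :
    Continuous fun x : (Pilots np K × Codebooks nd K M) × Noise np nd K L =>
      cleanObservation x.1.1 x.1.2 w x.2 := by
  have hH : Continuous fun x : (Pilots np K × Codebooks nd K M) × Noise np nd K L =>
      (Matrix.of x.2.1 : Matrix (Fin K) (Fin L) ℂ) := continuous_fst.comp continuous_snd
  unfold cleanObservation
  refine Continuous.prodMk (by fun_prop) (Continuous.prodMk (by fun_prop)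
    (Continuous.prodMk ?_ ?_))
  · exact Continuous.add ((continuous_pilotMatrix.comp (by fun_prop)).matrix_mul hH)
      (continuous_fst.comp (continuous_snd.comp continuous_snd))
  · exact Continuous.add (((continuous_selected _ w).comp (by fun_prop)).matrix_mul hH)
      (continuous_snd.comp (continuous_snd.comp continuous_snd))

-- Borel structures of nested products, recorded to keep instance search shallow.
instance : BorelSpace (Pilots np K × Codebooks nd K M) := inferInstance

instance : BorelSpace (Noise np nd K L) := inferInstance

instance : SecondCountableTopology (Noise np nd K L) := inferInstance

lemma measurable_metric_cleanObservation (w v : Fin K → Fin M) :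
    Measurable fun x : (Pilots np K × Codebooks nd K M) × Noise np nd K L =>
      metric (cleanObservation x.1.1 x.1.2 w x.2) v :=
  ((continuous_metric v).comp (continuous_cleanObservation w)).measurable

end Continuity

/-! ### Conditional error bounds given pilots and codebooks -/

section Conditional

open scoped ComplexOrder

lemma posSemidef_errorCov (b : Pilots np K) (a : Codebooks nd K M) (w : Fin K → Fin M) :
    (errorCov b a w).PosSemidef := by
  exact ((PosDef.one.add_posSemidef (posSemidef_conjTranspose_mul_self
    (pilotMatrix b))).inv.posSemidef).mul_mul_conjTranspose_same _

lemma rank_errorCov_le (b : Pilots np K) (a : Codebooks nd K M) (w : Fin K → Fin M) :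
    (errorCov b a w).rank ≤ min K nd := by
  refine le_min ?_ ?_
  · refine (Matrix.rank_mul_le_left _ _).trans ((Matrix.rank_mul_le_left _ _).trans ?_)
    simpa using Matrix.rank_le_card_width (selected a Finset.univ w)
  · simpa using Matrix.rank_le_card_height (errorCov b a w)

lemma noiseLaw_preimage_stack {s : Set (Fin K ⊕ (Fin np ⊕ Fin nd) → Fin L → ℂ)}
    (hs : MeasurableSet s) : noiseLaw np nd K L (stack ⁻¹' s) =
      gaussianArray (Fin K ⊕ (Fin np ⊕ Fin nd)) (Fin L) 1 s :=
  measurePreserving_stack.measure_preimage hs.nullMeasurableSet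

lemma noiseLaw_residual (b : Pilots np K) (a : Codebooks nd K M) (w : Fin K → Fin M) (τ : ℝ) :
    noiseLaw np nd K L {z | τ < metric (cleanObservation b a w z) w} =
      gaussianArray (Fin K ⊕ (Fin np ⊕ Fin nd)) (Fin L) 1 {Z | τ < energy
        (linImage (residualMatrix (pilotMatrix b) (selected a Finset.univ w)) Z)} := by
  simp_rw [metric_cleanObservation_self]
  exact noiseLaw_preimage_stack (measurableSet_lt measurable_const
    (continuous_energy.comp (continuous_linImage _)).measurable)

theorem noiseLaw_residual_le_chernoff (b : Pilots np K) (a : Codebooks nd K M) (w : Fin K → Fin M)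
    (ν : ℝ) :
    noiseLaw np nd K L {z | nd * L * ν < metric (cleanObservation b a w z) w} ≤
      ⨅ (δ : ℝ) (_ : 0 ≤ δ) (_ : δ < 1 / (1 + lambdaMax (errorCov b a w))),
        ENNReal.ofReal (Real.exp (-(δ * nd * L * ν)) *
          ((((1 - (δ : ℂ)) • (1 : Matrix (Fin nd) (Fin nd) ℂ)
            - (δ : ℂ) • errorCov b a w).det).re ^ L)⁻¹) := by
  refine le_iInf fun δ => le_iInf fun hδ => le_iInf fun hδ' => ?_
  rw [noiseLaw_residual]
  have h := gaussianArray_energy_le_chernoff (L := L) (posSemidef_errorCov b a w) _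
    (residualMatrix_mul_conjTranspose (pilotMatrix b) (selected a Finset.univ w)) (nd * L * ν) hδ hδ'
  rwa [show δ * (nd * L * ν) = δ * nd * L * ν by ring] at h

theorem noiseLaw_residual_le_gamma (hL : 1 ≤ L) (hK : 1 ≤ K) (hnd : 1 ≤ nd) (b : Pilots np K)
    (a : Codebooks nd K M) (w : Fin K → Fin M) (ν η : ℝ) :
    noiseLaw np nd K L {z | nd * L * ν < metric (cleanObservation b a w z) w} ≤
      ENNReal.ofReal (2 - lowerGamma (nd * L) (nd * L * η) / Real.Gamma (nd * L) -
        lowerGamma (L * (min K nd : ℕ)) (nd * L * (ν - η) / lambdaMax (errorCov b a w)) /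
          Real.Gamma (L * (min K nd : ℕ))) := by
  rw [noiseLaw_residual]
  have h := gaussianArray_energy_le_gamma (L := L) (posSemidef_errorCov b a w) _
    (residualMatrix_mul_conjTranspose (pilotMatrix b) (selected a Finset.univ w)) hL hnd
    (N := min K nd) (le_min hK hnd) (min_le_right _ _) (rank_errorCov_le b a w)
    (nd * L * η) (nd * L * (ν - η))
  rwa [show (nd : ℝ) * L * η + nd * L * (ν - η) = nd * L * ν by ring] at h

/-- The event that `v` is preferred to the transmitted `w`, and that the residual is small. -/
def confusionEvent (b : Pilots np K) (a : Codebooks nd K M) (w v : Fin K → Fin M) (τ : ℝ) :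
    Set (Noise np nd K L) :=
  {z | metric (cleanObservation b a w z) v ≤ metric (cleanObservation b a w z) w ∧
    metric (cleanObservation b a w z) w ≤ τ}

theorem noiseLaw_confusionEvent_le (b : Pilots np K) (a : Codebooks nd K M) {S : Finset (Fin K)}
    {w v : Fin K → Fin M} (hv : ∀ k ∉ S, v k = w k) (ν : ℝ) :
    noiseLaw np nd K L (confusionEvent b a w v (nd * L * ν)) ≤
      ⨅ (u : ℝ) (r : ℝ) (_ : 0 ≤ u) (_ : 0 ≤ r) (_ : EigenvaluesPos (matrixD b a S w v u r)),
        ENNReal.ofReal (Real.exp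
          (r * nd * L * ν - (L : ℝ) / 2 * Real.log (matrixD b a S w v u r).det)) := by
  refine le_iInf fun u => le_iInf fun r => le_iInf fun hu => le_iInf fun hr => le_iInf fun hD => ?_
  have hdiff : selected a Finset.univ w - selected a Finset.univ v =
      selected a S w - selected a S v := by
    ext i k
    simp only [Matrix.sub_apply, selected_apply, Finset.mem_univ, if_true]
    by_cases hk : k ∈ S
    · simp [hk]
    · simp [hk, hv k hk]
  set P₁ := residualMatrix (pilotMatrix b) (selected a Finset.univ w)
  set P₂ := confusionMatrix (pilotMatrix b) (selected a S w - selected a S v)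
  have hev : confusionEvent b a w v (nd * L * ν) = stack ⁻¹'
      {Z : Fin K ⊕ (Fin np ⊕ Fin nd) → Fin L → ℂ |
        energy (linImage P₁ Z + linImage P₂ Z) ≤ energy (linImage P₁ Z) ∧
        energy (linImage P₁ Z) ≤ nd * L * ν} := by
    ext z
    simp only [confusionEvent, metric_cleanObservation_self, metric_cleanObservation b a w v, hdiff]
    rfl
  have hc1 : Continuous fun Z : Fin K ⊕ (Fin np ⊕ Fin nd) → Fin L → ℂ => energy (linImage P₁ Z) :=
    continuous_energy.comp (continuous_linImage P₁)
  have hc2 : Continuous fun Z : Fin K ⊕ (Fin np ⊕ Fin nd) → Fin L → ℂ =>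
      energy (linImage P₁ Z + linImage P₂ Z) :=
    continuous_energy.comp ((continuous_linImage P₁).add (continuous_linImage P₂))
  have hmeas : MeasurableSet {Z : Fin K ⊕ (Fin np ⊕ Fin nd) → Fin L → ℂ |
      energy (linImage P₁ Z + linImage P₂ Z) ≤ energy (linImage P₁ Z) ∧
      energy (linImage P₁ Z) ≤ nd * L * ν} :=
    (measurableSet_le hc2.measurable hc1.measurable).inter
      (measurableSet_le hc1.measurable measurable_const)
  rw [hev, noiseLaw_preimage_stack hmeas]
  rw [matrixD_eq_realify] at hD ⊢
  have h := gaussianArray_confusion_le (L := L) (1 + errorCov b a w) (confusionCov b a S w v) P₁ P₂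
    (covariance_residual_confusion _ _ _) hu hr hD (nd * L * ν)
  rwa [show r * (nd * L * ν) = r * nd * L * ν by ring] at h

end Conditional

end Metric

/-! ### Exchangeability of users and messages -/

section Symmetry

open Matrix

variable {np nd K M L : ℕ}

lemma isProbabilityMeasure_sphereLaw {m : ℕ} (hm : 1 ≤ m) (ρ : ℝ) :
    IsProbabilityMeasure (sphereLaw m ρ) := by
  have : Nonempty (Fin m) := ⟨⟨0, hm⟩⟩
  have : Nontrivial (EuclideanSpace ℂ (Fin m)) := by infer_instance
  unfold sphereLaw
  set ν := (volume : Measure (EuclideanSpace ℂ (Fin m))).toSphere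
  have hν : ν ≠ 0 := Measure.toSphere_ne_zero _
  have h : IsProbabilityMeasure ((ν Set.univ)⁻¹ • ν) := ⟨by
    rw [Measure.smul_apply, smul_eq_mul]
    exact ENNReal.inv_mul_cancel (by simpa using hν) (measure_ne_top _ _)⟩
  exact Measure.isProbabilityMeasure_map (by fun_prop)

lemma isProbabilityMeasure_pilotLaw (hnp : 1 ≤ np) (Pp : ℝ) :
    IsProbabilityMeasure (pilotLaw np K Pp) := by
  have := isProbabilityMeasure_sphereLaw hnp (Real.sqrt (np * Pp))
  unfold pilotLaw
  infer_instance

instance isProbabilityMeasure_codebookLaw (P' : ℝ) :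
    IsProbabilityMeasure (codebookLaw nd K M P') := by
  unfold codebookLaw; infer_instance

/-- Permuting the coordinates of a power of a measurable space. -/
noncomputable def permCoords {ι : Type} (X : Type) [MeasurableSpace X] (e : Equiv.Perm ι) :
    (ι → X) ≃ᵐ (ι → X) :=
  MeasurableEquiv.piCongrLeft (fun _ => X) e.symm

lemma permCoords_apply {ι X : Type} [MeasurableSpace X] (e : Equiv.Perm ι) (x : ι → X) (i : ι) :
    permCoords X e x i = x (e i) := by
  have h := MeasurableEquiv.piCongrLeft_apply_apply (β := fun _ : ι => X) e.symm x (e i)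
  rwa [Equiv.symm_apply_apply] at h

lemma measurePreserving_permCoords {ι X : Type} [Fintype ι] [MeasurableSpace X] (μ : Measure X)
    [SigmaFinite μ] (e : Equiv.Perm ι) :
    MeasurePreserving (permCoords X e) (Measure.pi fun _ => μ) (Measure.pi fun _ => μ) :=
  measurePreserving_piCongrLeft (fun _ => μ) e.symm

/-- Renaming users by `σ` and the messages of user `k` by `π k`. -/
noncomputable def relabel (σ : Equiv.Perm (Fin K)) (π : Fin K → Equiv.Perm (Fin M)) :
    (Pilots np K × Codebooks nd K M) ≃ᵐ (Pilots np K × Codebooks nd K M) :=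
  (permCoords _ σ).prodCongr
    (MeasurableEquiv.piCongrRight fun _ : Fin nd => permCoords ℂ (σ.prodShear π))

lemma relabel_fst (σ : Equiv.Perm (Fin K)) (π : Fin K → Equiv.Perm (Fin M))
    (x : Pilots np K × Codebooks nd K M) (k : Fin K) : (relabel σ π x).1 k = x.1 (σ k) :=
  permCoords_apply σ x.1 k

lemma relabel_snd (σ : Equiv.Perm (Fin K)) (π : Fin K → Equiv.Perm (Fin M))
    (x : Pilots np K × Codebooks nd K M) (i : Fin nd) (k : Fin K) (m : Fin M) :
    (relabel σ π x).2 i (k, m) = x.2 i (σ k, π k m) :=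
  permCoords_apply (σ.prodShear π) (x.2 i) (k, m)

lemma measurePreserving_relabel (hnp : 1 ≤ np) (Pp P' : ℝ) (σ : Equiv.Perm (Fin K))
    (π : Fin K → Equiv.Perm (Fin M)) :
    MeasurePreserving (relabel σ π) ((pilotLaw np K Pp).prod (codebookLaw nd K M P'))
      ((pilotLaw np K Pp).prod (codebookLaw nd K M P')) := by
  have := isProbabilityMeasure_sphereLaw hnp (Real.sqrt (np * Pp))
  have := isProbabilityMeasure_pilotLaw (K := K) hnp Pp
  have h1 : MeasurePreserving (permCoords (EuclideanSpace ℂ (Fin np)) σ) (pilotLaw np K Pp)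
      (pilotLaw np K Pp) := measurePreserving_permCoords _ σ
  have h2 : MeasurePreserving
      (fun (a : Codebooks nd K M) i => permCoords ℂ (σ.prodShear π) (a i))
      (codebookLaw nd K M P') (codebookLaw nd K M P') :=
    measurePreserving_pi _ _ fun _ =>
      measurePreserving_permCoords (complexGaussian P'.toNNReal) (σ.prodShear π)
  exact h1.prod h2

lemma submatrix_mul_mul_conjTranspose (σ : Equiv.Perm (Fin K)) (A : Matrix (Fin nd) (Fin K) ℂ)
    (X : Matrix (Fin K) (Fin K) ℂ) :
    A.submatrix id σ * X.submatrix σ σ * (A.submatrix id σ)ᴴ = A * X * Aᴴ := by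
  rw [conjTranspose_submatrix, submatrix_mul_equiv, submatrix_mul_equiv, submatrix_id_id]

lemma sigmaTilde_submatrix (σ : Equiv.Perm (Fin K)) (B : Matrix (Fin np) (Fin K) ℂ) :
    sigmaTilde (B.submatrix id σ) = (sigmaTilde B).submatrix σ σ := by
  have h : (1 + Bᴴ * B).submatrix σ σ = 1 + (Bᴴ * B).submatrix σ σ := by
    ext i j
    simp [Matrix.one_apply]
  rw [sigmaTilde, sigmaTilde, ← inv_submatrix_equiv, conjTranspose_submatrix,
    ← submatrix_mul _ _ _ _ _ Function.bijective_id, h]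

lemma sigmaHat_submatrix (σ : Equiv.Perm (Fin K)) (B : Matrix (Fin np) (Fin K) ℂ) :
    sigmaHat (B.submatrix id σ) = (sigmaHat B).submatrix σ σ := by
  have h := sigmaTilde_submatrix σ B
  rw [sigmaTilde, sigmaTilde] at h
  rw [sigmaHat, sigmaHat, h]
  ext i j
  simp [Matrix.one_apply]

lemma pilotMatrix_relabel (σ : Equiv.Perm (Fin K)) (π : Fin K → Equiv.Perm (Fin M))
    (x : Pilots np K × Codebooks nd K M) :
    pilotMatrix (relabel σ π x).1 = (pilotMatrix x.1).submatrix id σ := by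
  ext i k
  simp [pilotMatrix, relabel_fst]

lemma selected_relabel {σ : Equiv.Perm (Fin K)} {π : Fin K → Equiv.Perm (Fin M)}
    {S S' : Finset (Fin K)} {w w' : Fin K → Fin M} (hS : ∀ k, σ k ∈ S' ↔ k ∈ S)
    (hw : ∀ k ∈ S, π k (w k) = w' (σ k)) (x : Pilots np K × Codebooks nd K M) :
    selected (relabel σ π x).2 S w = (selected x.2 S' w').submatrix id σ := by
  ext i k
  rw [submatrix_apply, selected_apply, selected_apply, relabel_snd]
  by_cases hk : k ∈ S
  · rw [if_pos hk, if_pos ((hS k).2 hk), hw k hk, id]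
  · rw [if_neg hk, if_neg (fun h => hk ((hS k).1 h))]

lemma exists_perm_pair {α : Type} [DecidableEq α] {x y x' y' : α} (h : x ≠ y) (h' : x' ≠ y') :
    ∃ π : Equiv.Perm α, π x = x' ∧ π y = y' := by
  refine ⟨Equiv.swap (Equiv.swap x x' y) y' * Equiv.swap x x', ?_, ?_⟩
  · rw [Equiv.Perm.mul_apply, Equiv.swap_apply_left, Equiv.swap_apply_of_ne_of_ne _ h']
    intro hcon
    rw [← Equiv.swap_apply_left x x'] at hcon
    exact h ((Equiv.swap x x').injective (by simpa using hcon))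
  · rw [Equiv.Perm.mul_apply, Equiv.swap_apply_left]

/-- The joint law of the covariances in the bound does not depend on the messages, nor on which
users are decoded wrongly. -/
theorem exists_relabel {S S' : Finset (Fin K)} (hcard : S.card = S'.card) {w w' v v' : Fin K → Fin M}
    (hw : ∀ k, w k ≠ w' k) (hv : ∀ k ∈ S', v k ≠ v' k) :
    ∃ (σ : Equiv.Perm (Fin K)) (π : Fin K → Equiv.Perm (Fin M)),
      ∀ x : Pilots np K × Codebooks nd K M,
        errorCov (relabel σ π x).1 (relabel σ π x).2 w = errorCov x.1 x.2 v ∧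
        confusionCov (relabel σ π x).1 (relabel σ π x).2 S w w' = confusionCov x.1 x.2 S' v v' := by
  have e : {k // k ∈ S} ≃ {k // k ∈ S'} := Finset.equivOfCardEq hcard
  set σ : Equiv.Perm (Fin K) := e.extendSubtype
  have hσ : ∀ k, σ k ∈ S' ↔ k ∈ S := fun k => by
    by_cases hk : k ∈ S
    · exact iff_of_true (e.extendSubtype_mem k hk) hk
    · exact iff_of_false (e.extendSubtype_not_mem k hk) hk
  have hπ : ∀ k, ∃ π : Equiv.Perm (Fin M), π (w k) = v (σ k) ∧ (k ∈ S → π (w' k) = v' (σ k)) := by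
    intro k
    by_cases hk : k ∈ S
    · obtain ⟨π, h1, h2⟩ := exists_perm_pair (hw k) (hv (σ k) ((hσ k).2 hk))
      exact ⟨π, h1, fun _ => h2⟩
    · exact ⟨Equiv.swap (w k) (v (σ k)), Equiv.swap_apply_left _ _, fun h => absurd h hk⟩
  choose π h1 h2 using hπ
  refine ⟨σ, π, fun x => ⟨?_, ?_⟩⟩
  · rw [errorCov, errorCov, pilotMatrix_relabel, sigmaTilde_submatrix,
      selected_relabel (S' := Finset.univ) (w' := v) (by simp) (fun k _ => h1 k),
      submatrix_mul_mul_conjTranspose]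
  · rw [confusionCov, confusionCov, pilotMatrix_relabel, sigmaHat_submatrix,
      selected_relabel hσ (fun k _ => h1 k), selected_relabel hσ (fun k hk => h2 k hk)]
    exact submatrix_mul_mul_conjTranspose σ (selected x.2 S' v - selected x.2 S' v') _

end Symmetry

/-! ### Energy of a codeword -/

section CodewordEnergy

variable {nd K M : ℕ}

lemma measurePreserving_complexGaussian_scale (v : ℝ≥0) :
    MeasurePreserving (fun z : ℂ => (√v : ℂ) * z) (complexGaussian 1) (complexGaussian v) := by
  refine ⟨by fun_prop, ?_⟩
  have hg : (gaussianReal 0 (1 / 2)).map (√(v : ℝ) * ·) = gaussianReal 0 (v / 2) := by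
    rw [gaussianReal_map_const_mul]
    congr 1
    · simp
    · ext
      simp [div_eq_mul_inv]
  rw [complexGaussian_eq_map, complexGaussian_eq_map, Measure.map_map (by fun_prop)
    Complex.measurableEquivRealProd.symm.measurable, ← hg,
    Measure.map_prod_map _ _ (by fun_prop) (by fun_prop),
    Measure.map_map Complex.measurableEquivRealProd.symm.measurable (by fun_prop)]
  congr 1
  funext p
  simp only [Function.comp_apply, Prod.map, Complex.measurableEquivRealProd_symm_apply]
  apply Complex.ext <;> simp

/-- The probability that the energy of a codeword exceeds the limit `E`. -/
theorem codebookLaw_energy_gt (hnd : 1 ≤ nd) {P' : ℝ} (hP' : 0 < P') (E : ℝ) (k : Fin K)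
    (m : Fin M) :
    codebookLaw nd K M P' {a | E < ∑ j, ‖a j (k, m)‖ ^ 2} =
      ENNReal.ofReal (1 - lowerGamma nd (E / P') / Real.Gamma nd) := by
  have : Nonempty (Fin nd) := ⟨⟨0, hnd⟩⟩
  have h1 : MeasurePreserving (fun (a : Codebooks nd K M) (j : Fin nd) => a j (k, m))
      (codebookLaw nd K M P') (Measure.pi fun _ => complexGaussian P'.toNNReal) :=
    measurePreserving_pi _ _ fun _ => measurePreserving_eval _ (k, m)
  have h2 : MeasurePreserving
      (fun (Z : Fin nd → Unit → ℂ) (j : Fin nd) => (√P'.toNNReal : ℂ) * Z j ())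
      (gaussianArray (Fin nd) Unit 1) (Measure.pi fun _ => complexGaussian P'.toNNReal) :=
    measurePreserving_pi (fun _ => Measure.pi fun _ => complexGaussian 1)
      (fun _ => complexGaussian P'.toNNReal) fun _ =>
        (measurePreserving_complexGaussian_scale P'.toNNReal).comp
          (measurePreserving_eval (fun _ : Unit => complexGaussian 1) ())
  have hs : MeasurableSet {c : Fin nd → ℂ | E < ∑ j, ‖c j‖ ^ 2} :=
    measurableSet_lt measurable_const (by fun_prop)
  have h3 := h1.measure_preimage hs.nullMeasurableSet
  rw [← h2.measure_preimage hs.nullMeasurableSet] at h3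
  rw [← gaussianArray_energy_gt (ι := Fin nd) (κ := Unit) (N := nd) (by simp)]
  refine h3.trans (congrArg _ ?_)
  ext Z
  simp only [Set.mem_preimage, Set.mem_ofPred_eq, energy, norm_mul, mul_pow, ← Finset.mul_sum]
  rw [div_lt_iff₀ hP', Complex.norm_real, Real.norm_of_nonneg (Real.sqrt_nonneg _),
    Real.sq_sqrt (NNReal.coe_nonneg _), Real.coe_toNNReal _ hP'.le, mul_comm]
  simp

end CodewordEnergy

/-! ### Averaging over pilots and codebooks -/

section Averages

variable {np nd K M L : ℕ}

/-- The event that the residual has energy larger than `τ`. -/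
def tailEvent (b : Pilots np K) (a : Codebooks nd K M) (w : Fin K → Fin M) (τ : ℝ) :
    Set (Noise np nd K L) :=
  {z | τ < metric (cleanObservation b a w z) w}

lemma measurable_noiseLaw_section
    {s : Set ((Pilots np K × Codebooks nd K M) × Noise np nd K L)} (hs : MeasurableSet s) :
    Measurable fun x => noiseLaw np nd K L (Prod.mk x ⁻¹' s) :=
  measurable_measure_prodMk_left hs

lemma measurable_noiseLaw_tailEvent (w : Fin K → Fin M) (τ : ℝ) :
    Measurable fun x : Pilots np K × Codebooks nd K M =>
      noiseLaw np nd K L (tailEvent x.1 x.2 w τ) :=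
  measurable_noiseLaw_section (s := {p | τ < metric (cleanObservation p.1.1 p.1.2 w p.2) w})
    (measurableSet_lt measurable_const (measurable_metric_cleanObservation w w))

lemma measurable_noiseLaw_confusionEvent (w v : Fin K → Fin M) (τ : ℝ) :
    Measurable fun x : Pilots np K × Codebooks nd K M =>
      noiseLaw np nd K L (confusionEvent x.1 x.2 w v τ) :=
  measurable_noiseLaw_section (s := {p | metric (cleanObservation p.1.1 p.1.2 w p.2) v ≤
      metric (cleanObservation p.1.1 p.1.2 w p.2) w ∧
      metric (cleanObservation p.1.1 p.1.2 w p.2) w ≤ τ})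
    ((measurableSet_le (measurable_metric_cleanObservation w v)
      (measurable_metric_cleanObservation w w)).inter
      (measurableSet_le (measurable_metric_cleanObservation w w) measurable_const))

/-- The infimum under the expectation in `q_{1,t}(ν)`. -/
noncomputable def confusionExponent (L : ℕ) (S : Finset (Fin K)) (w w' : Fin K → Fin M) (ν : ℝ)
    (x : Pilots np K × Codebooks nd K M) : ℝ≥0∞ :=
  ⨅ (u : ℝ) (r : ℝ) (_ : 0 ≤ u) (_ : 0 ≤ r) (_ : EigenvaluesPos (matrixD x.1 x.2 S w w' u r)),
    ENNReal.ofReal (Real.exp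
      (r * nd * L * ν - (L : ℝ) / 2 * Real.log (matrixD x.1 x.2 S w w' u r).det))

lemma lintegral_confusionEvent_le (hnp : 1 ≤ np) (Pp P' : ℝ) {S S' : Finset (Fin K)}
    (hcard : S.card = S'.card) {w w' w₀ v : Fin K → Fin M} (hw : ∀ k, w k ≠ w' k)
    (hv : ∀ k ∈ S', v k ≠ w₀ k) (hv' : ∀ k ∉ S', v k = w₀ k) (ν : ℝ) :
    ∫⁻ x, noiseLaw np nd K L (confusionEvent x.1 x.2 w₀ v (nd * L * ν))
        ∂((pilotLaw np K Pp).prod (codebookLaw nd K M P')) ≤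
      ∫⁻ x, confusionExponent L S w w' ν x
        ∂((pilotLaw np K Pp).prod (codebookLaw nd K M P')) := by
  obtain ⟨σ, π, h⟩ := exists_relabel (np := np) (nd := nd) hcard hw (fun k hk => (hv k hk).symm)
  refine le_trans (lintegral_mono fun x => ?_)
    ((measurePreserving_relabel hnp Pp P' σ π).lintegral_comp_emb
      (MeasurableEquiv.measurableEmbedding _) (confusionExponent L S w w' ν)).le
  have hD : ∀ u r, matrixD (relabel σ π x).1 (relabel σ π x).2 S w w' u r =
      matrixD x.1 x.2 S' w₀ v u r := fun u r => by
    rw [matrixD, matrixD, (h x).1, (h x).2]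
  have hx : confusionExponent L S w w' ν (relabel σ π x) = confusionExponent L S' w₀ v ν x := by
    unfold confusionExponent
    simp only [hD]
  rw [hx]
  exact noiseLaw_confusionEvent_le x.1 x.2 hv' ν

lemma exists_relabel_errorCov {w w' : Fin K → Fin M} (hw : ∀ k, w k ≠ w' k) (w₀ : Fin K → Fin M) :
    ∃ (σ : Equiv.Perm (Fin K)) (π : Fin K → Equiv.Perm (Fin M)),
      ∀ x : Pilots np K × Codebooks nd K M,
        errorCov (relabel σ π x).1 (relabel σ π x).2 w = errorCov x.1 x.2 w₀ := by
  obtain ⟨σ, π, h⟩ := exists_relabel (np := np) (nd := nd) (S := ∅) (S' := ∅) rfl hw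
    (v := w₀) (v' := w₀) (by simp)
  exact ⟨σ, π, fun x => (h x).1⟩

/-- The infimum under the expectation in the Chernoff form of `q_{2,t}(ν)`. -/
noncomputable def tailExponent (L : ℕ) (w : Fin K → Fin M) (ν : ℝ)
    (x : Pilots np K × Codebooks nd K M) : ℝ≥0∞ :=
  ⨅ (δ : ℝ) (_ : 0 ≤ δ) (_ : δ < 1 / (1 + lambdaMax (errorCov x.1 x.2 w))),
    ENNReal.ofReal (Real.exp (-(δ * nd * L * ν)) *
      ((((1 - (δ : ℂ)) • (1 : Matrix (Fin nd) (Fin nd) ℂ)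
        - (δ : ℂ) • errorCov x.1 x.2 w).det).re ^ L)⁻¹)

lemma lintegral_tailEvent_le_q2Chernoff (hnp : 1 ≤ np) (Pp P' : ℝ) {w w' : Fin K → Fin M}
    (hw : ∀ k, w k ≠ w' k) (w₀ : Fin K → Fin M) (ν : ℝ) :
    ∫⁻ x, noiseLaw np nd K L (tailEvent x.1 x.2 w₀ (nd * L * ν))
        ∂((pilotLaw np K Pp).prod (codebookLaw nd K M P')) ≤
      q2Chernoff (nd := nd) np L Pp P' w ν := by
  obtain ⟨σ, π, h⟩ := exists_relabel_errorCov (np := np) (nd := nd) hw w₀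
  refine le_trans (lintegral_mono fun x => ?_)
    ((measurePreserving_relabel hnp Pp P' σ π).lintegral_comp_emb
      (MeasurableEquiv.measurableEmbedding _) (tailExponent L w ν)).le
  have hx : tailExponent L w ν (relabel σ π x) = tailExponent L w₀ ν x := by
    unfold tailExponent
    rw [h x]
  rw [hx]
  exact noiseLaw_residual_le_chernoff x.1 x.2 w₀ ν

lemma lintegral_tailEvent_le_q2Gamma (hnp : 1 ≤ np) (hL : 1 ≤ L) (hK : 1 ≤ K) (hnd : 1 ≤ nd)
    (Pp P' : ℝ) {w w' : Fin K → Fin M} (hw : ∀ k, w k ≠ w' k) (w₀ : Fin K → Fin M) (ν : ℝ) :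
    ∫⁻ x, noiseLaw np nd K L (tailEvent x.1 x.2 w₀ (nd * L * ν))
        ∂((pilotLaw np K Pp).prod (codebookLaw nd K M P')) ≤
      q2Gamma (nd := nd) np L Pp P' w ν := by
  have := isProbabilityMeasure_pilotLaw (K := K) hnp Pp
  refine le_iInf fun η => le_iInf fun _ => le_iInf fun _ => ?_
  obtain ⟨σ, π, h⟩ := exists_relabel_errorCov (np := np) (nd := nd) hw w₀
  rw [← (measurePreserving_relabel hnp Pp P' σ π).integral_comp
    (MeasurableEquiv.measurableEmbedding _)]
  simp only [h]
  set μ := (pilotLaw np K Pp).prod (codebookLaw nd K M P')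
  set f : Pilots np K × Codebooks nd K M → ℝ := fun x => lowerGamma (L * (min K nd : ℕ))
    (nd * L * (ν - η) / lambdaMax (errorCov x.1 x.2 w₀)) / Real.Gamma (L * (min K nd : ℕ)) with hf
  set c : ℝ := lowerGamma (nd * L) (nd * L * η) / Real.Gamma (nd * L) with hc
  have hmin : 0 < min K nd := lt_min hK hnd
  have hc1 : c ≤ 1 := lowerGamma_div_Gamma_le_one (by positivity) _
  have hf1 : ∀ x, f x ≤ 1 := fun x => lowerGamma_div_Gamma_le_one (by positivity) _
  by_cases hint : Integrable f μ
  · have hint' : Integrable (fun x => 2 - c - f x) μ := (integrable_const _).sub hint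
    have h2 : 2 - c - ∫ x, f x ∂μ = ∫ x, (2 - c - f x) ∂μ := by
      rw [integral_sub (integrable_const _) hint]
      simp
    rw [h2, ofReal_integral_eq_lintegral_ofReal hint'
      (Filter.Eventually.of_forall fun x => by
        have := hf1 x
        simp only [Pi.zero_apply]
        linarith)]
    exact lintegral_mono fun x => noiseLaw_residual_le_gamma hL hK hnd x.1 x.2 w₀ ν η
  · -- The integrand is bounded and measurable, so this case is vacuous; as the bound would be at
    -- least `1` here, the measurability of `λ_max` is not needed.
    rw [integral_undef hint, sub_zero]
    calc _ ≤ ∫⁻ _, 1 ∂μ := lintegral_mono fun x => prob_le_one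
      _ = 1 := by simp
      _ ≤ _ := by
        rw [ENNReal.one_le_ofReal]
        linarith

/-- The messages with errors, with respect to `w`, exactly at the users in `S`. -/
def confusable (S : Finset (Fin K)) (w : Fin K → Fin M) : Finset (Fin K → Fin M) :=
  Finset.univ.filter fun v => ∀ k, v k ≠ w k ↔ k ∈ S

lemma card_confusable_le (S : Finset (Fin K)) (w : Fin K → Fin M) :
    (confusable S w).card ≤ M ^ S.card := by
  have hsub : confusable S w ⊆
      Fintype.piFinset fun k => if k ∈ S then (Finset.univ : Finset (Fin M)) else {w k} := by
    intro v hv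
    rw [Fintype.mem_piFinset]
    intro k
    by_cases hk : k ∈ S
    · simp [hk]
    · have := ((Finset.mem_filter.1 hv).2 k).not.2 hk
      simpa [hk] using this
  refine (Finset.card_le_card hsub).trans ?_
  rw [Fintype.card_piFinset]
  have : ∀ k, (if k ∈ S then (Finset.univ : Finset (Fin M)) else {w k}).card =
      if k ∈ S then M else 1 := fun k => by split_ifs <;> simp
  simp only [this, Finset.prod_ite_mem, Finset.univ_inter, Finset.prod_const, le_refl]

/-- Given the transmitted messages, the union bound over the wrong messages with `t` errors. -/
theorem lintegral_error_le_pt (hnp : 1 ≤ np) (hL : 1 ≤ L) (hK : 1 ≤ K) (hnd : 1 ≤ nd)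
    (Pp P' : ℝ) {t : ℕ} {S : Finset (Fin K)} (hS : S.card = t) {w w' : Fin K → Fin M}
    (hw : ∀ k, w k ≠ w' k) {dec : Observation np nd K M L → Fin K → Fin M}
    (hdec : IsNearestNeighbour dec) (w₀ : Fin K → Fin M) :
    ∫⁻ x, noiseLaw np nd K L {z | (Finset.univ.filter fun k =>
        w₀ k ≠ dec (cleanObservation x.1 x.2 w₀ z) k).card = t}
        ∂((pilotLaw np K Pp).prod (codebookLaw nd K M P')) ≤
      pt np nd L Pp P' t S w w' := by
  have := isProbabilityMeasure_pilotLaw (K := K) hnp Pp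
  refine le_iInf fun ν => le_iInf fun _ => ?_
  set τ : ℝ := nd * L * ν
  have hpoint : ∀ x : Pilots np K × Codebooks nd K M,
      noiseLaw np nd K L {z | (Finset.univ.filter fun k =>
        w₀ k ≠ dec (cleanObservation x.1 x.2 w₀ z) k).card = t} ≤
      noiseLaw np nd K L (tailEvent x.1 x.2 w₀ τ) +
        ∑ S' ∈ Finset.powersetCard t Finset.univ, ∑ v ∈ confusable S' w₀,
          noiseLaw np nd K L (confusionEvent x.1 x.2 w₀ v τ) := by
    intro x
    have hsub : {z : Noise np nd K L | (Finset.univ.filter fun k =>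
        w₀ k ≠ dec (cleanObservation x.1 x.2 w₀ z) k).card = t} ⊆
        tailEvent x.1 x.2 w₀ τ ∪ ⋃ S' ∈ Finset.powersetCard t Finset.univ,
          ⋃ v ∈ confusable S' w₀, confusionEvent x.1 x.2 w₀ v τ := by
      intro z hz
      by_cases htail : z ∈ tailEvent x.1 x.2 w₀ τ
      · exact Or.inl htail
      · refine Or.inr ?_
        simp only [Set.mem_iUnion]
        refine ⟨Finset.univ.filter fun k => w₀ k ≠ dec (cleanObservation x.1 x.2 w₀ z) k, ?_,
          dec (cleanObservation x.1 x.2 w₀ z), ?_, ?_, ?_⟩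
        · rw [Finset.mem_powersetCard]
          exact ⟨Finset.subset_univ _, hz⟩
        · simp [confusable, ne_comm]
        · exact hdec.2 _ _
        · exact not_lt.1 htail
    refine (measure_mono hsub).trans ((measure_union_le _ _).trans (add_le_add le_rfl ?_))
    refine (measure_biUnion_finset_le _ _).trans (Finset.sum_le_sum fun S' _ => ?_)
    exact measure_biUnion_finset_le _ _
  refine (lintegral_mono hpoint).trans ?_
  rw [lintegral_add_left (measurable_noiseLaw_tailEvent w₀ τ), add_comm]
  refine add_le_add ?_ (le_min (lintegral_tailEvent_le_q2Chernoff hnp Pp P' hw w₀ ν)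
    (lintegral_tailEvent_le_q2Gamma hnp hL hK hnd Pp P' hw w₀ ν))
  rw [lintegral_finsetSum _ fun S' _ => Finset.measurable_fun_sum _ fun v _ =>
    measurable_noiseLaw_confusionEvent w₀ v τ]
  have hq1 : q1 (nd := nd) np L Pp P' t S w w' ν = (K.choose t : ℝ≥0∞) * (M : ℝ≥0∞) ^ t *
      ∫⁻ x, confusionExponent L S w w' ν x
        ∂((pilotLaw np K Pp).prod (codebookLaw nd K M P')) := rfl
  rw [hq1]
  set I := ∫⁻ x, confusionExponent L S w w' ν x
        ∂((pilotLaw np K Pp).prod (codebookLaw nd K M P'))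
  calc _ ≤ ∑ S' ∈ Finset.powersetCard t (Finset.univ : Finset (Fin K)), (M : ℝ≥0∞) ^ t * I := by
        refine Finset.sum_le_sum fun S' hS' => ?_
        have hS'c : S'.card = t := (Finset.mem_powersetCard.1 hS').2
        rw [lintegral_finsetSum _ fun v _ => measurable_noiseLaw_confusionEvent w₀ v τ]
        calc _ ≤ ∑ v ∈ confusable S' w₀, I := by
              refine Finset.sum_le_sum fun v hv => ?_
              have hv2 := (Finset.mem_filter.1 hv).2
              exact lintegral_confusionEvent_le hnp Pp P' (hS.trans hS'c.symm) hw
                (fun k hk => (hv2 k).2 hk) (fun k hk => not_not.1 ((hv2 k).not.2 hk)) ν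
          _ = ((confusable S' w₀).card : ℝ≥0∞) * I := by rw [Finset.sum_const, nsmul_eq_mul]
          _ ≤ (M : ℝ≥0∞) ^ t * I := by
              gcongr
              rw [← hS'c]
              exact_mod_cast card_confusable_le S' w₀
    _ = _ := by
        rw [Finset.sum_const, Finset.card_powersetCard, Finset.card_univ, Fintype.card_fin,
          nsmul_eq_mul, mul_assoc]

end Averages

/-! ### The error probability of the scheme -/

section Scheme

variable {np nd K M L : ℕ}

lemma isProbabilityMeasure_messageLaw (hM : 1 ≤ M) : IsProbabilityMeasure (messageLaw K M) := by
  have : Nonempty (Fin M) := ⟨⟨0, hM⟩⟩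
  have : IsProbabilityMeasure (uniformOn (Set.univ : Set (Fin M))) :=
    isProbabilityMeasure_uniformOn Set.finite_univ Set.univ_nonempty
  unfold messageLaw
  infer_instance

lemma schemeLaw_eq (Pp P' : ℝ) : schemeLaw np nd K M L Pp P' = (pilotLaw np K Pp).prod
    ((codebookLaw nd K M P').prod ((messageLaw K M).prod (noiseLaw np nd K L))) := rfl

lemma isProbabilityMeasure_schemeLaw (hnp : 1 ≤ np) (hM : 1 ≤ M) (Pp P' : ℝ) :
    IsProbabilityMeasure (schemeLaw np nd K M L Pp P') := by
  have := isProbabilityMeasure_pilotLaw (K := K) hnp Pp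
  have := isProbabilityMeasure_messageLaw (K := K) hM
  rw [schemeLaw_eq]
  infer_instance

/-- The event, on the whole sample space, given by an event for each value of the messages. -/
def messageEvent (A : (Fin K → Fin M) → Set ((Pilots np K × Codebooks nd K M) × Noise np nd K L)) :
    Set (Sample np nd K M L) :=
  {ω | ((ω.1, ω.2.1), ω.2.2.2) ∈ A ω.2.2.1}

lemma measurableSet_messageEvent
    {A : (Fin K → Fin M) → Set ((Pilots np K × Codebooks nd K M) × Noise np nd K L)}
    (hA : ∀ w, MeasurableSet (A w)) : MeasurableSet (messageEvent A) := by
  have h : messageEvent A = ⋃ w, ((fun ω : Sample np nd K M L => ω.2.2.1) ⁻¹' {w} ∩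
      (fun ω : Sample np nd K M L => (((ω.1, ω.2.1), ω.2.2.2) :
        (Pilots np K × Codebooks nd K M) × Noise np nd K L)) ⁻¹' A w) := by
    ext ω
    simp only [messageEvent, Set.mem_ofPred_eq, Set.mem_iUnion, Set.mem_inter_iff,
      Set.mem_preimage, Set.mem_singleton_iff]
    constructor
    · intro hω
      exact ⟨_, rfl, hω⟩
    · rintro ⟨w, rfl, hω⟩
      exact hω
  rw [h]
  refine MeasurableSet.iUnion fun w => MeasurableSet.inter ?_ ?_
  · exact measurableSet_preimage (by fun_prop) (measurableSet_singleton w)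
  · exact measurableSet_preimage (by fun_prop) (hA w)

/-- A bound that holds conditionally on every value of the messages holds on average. -/
theorem schemeLaw_messageEvent_le (hnp : 1 ≤ np) (hM : 1 ≤ M) (Pp P' : ℝ)
    {A : (Fin K → Fin M) → Set ((Pilots np K × Codebooks nd K M) × Noise np nd K L)}
    (hA : ∀ w, MeasurableSet (A w)) {C : ℝ≥0∞}
    (hC : ∀ w, ∫⁻ x, noiseLaw np nd K L (Prod.mk x ⁻¹' A w)
      ∂((pilotLaw np K Pp).prod (codebookLaw nd K M P')) ≤ C) :
    schemeLaw np nd K M L Pp P' (messageEvent A) ≤ C := by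
  have := isProbabilityMeasure_pilotLaw (K := K) hnp Pp
  have := isProbabilityMeasure_messageLaw (K := K) hM
  have hm := measurableSet_messageEvent hA
  have hassoc := (measurePreserving_prodAssoc (pilotLaw np K Pp) (codebookLaw nd K M P')
    ((messageLaw K M).prod (noiseLaw np nd K L)))
  rw [schemeLaw_eq, ← hassoc.measure_preimage hm.nullMeasurableSet,
    Measure.prod_apply (hassoc.measurable hm)]
  have hg : Measurable fun p : (Pilots np K × Codebooks nd K M) × (Fin K → Fin M) =>
      noiseLaw np nd K L (Prod.mk p.1 ⁻¹' A p.2) := by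
    refine measurable_from_prod_countable_left fun w => ?_
    exact measurable_noiseLaw_section (hA w)
  calc _ = ∫⁻ x, ∫⁻ w, noiseLaw np nd K L (Prod.mk x ⁻¹' A w) ∂(messageLaw K M)
          ∂((pilotLaw np K Pp).prod (codebookLaw nd K M P')) := by
        refine lintegral_congr fun x => ?_
        rw [Measure.prod_apply (measurable_prodMk_left (hassoc.measurable hm))]
        rfl
    _ = ∫⁻ w, ∫⁻ x, noiseLaw np nd K L (Prod.mk x ⁻¹' A w)
          ∂((pilotLaw np K Pp).prod (codebookLaw nd K M P')) ∂(messageLaw K M) :=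
        lintegral_lintegral_swap hg.aemeasurable
    _ ≤ ∫⁻ _, C ∂(messageLaw K M) := lintegral_mono hC
    _ = C := by simp

/-- Some transmitted codeword exceeds the energy limit. -/
def overload (np L : ℕ) (E : ℝ) (w : Fin K → Fin M) :
    Set ((Pilots np K × Codebooks nd K M) × Noise np nd K L) :=
  {p | ∃ k, E < ∑ j, ‖p.1.2 j (k, w k)‖ ^ 2}

/-- No codeword is replaced by zero, and exactly the users in some set of size `t` are decoded
wrongly. -/
def errorCount (E : ℝ) (dec : Observation np nd K M L → Fin K → Fin M) (t : ℕ)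
    (w : Fin K → Fin M) : Set ((Pilots np K × Codebooks nd K M) × Noise np nd K L) :=
  (overload np L E w)ᶜ ∩ {p | (Finset.univ.filter fun k =>
    w k ≠ dec (cleanObservation p.1.1 p.1.2 w p.2) k).card = t}

/-- No codeword is replaced by zero, and user `k` is decoded wrongly. -/
def userError (E : ℝ) (dec : Observation np nd K M L → Fin K → Fin M) (k : Fin K)
    (w : Fin K → Fin M) : Set ((Pilots np K × Codebooks nd K M) × Noise np nd K L) :=
  (overload np L E w)ᶜ ∩ {p | w k ≠ dec (cleanObservation p.1.1 p.1.2 w p.2) k}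

lemma measurableSet_overload (E : ℝ) (w : Fin K → Fin M) :
    MeasurableSet (overload (nd := nd) np L E w) := by
  have h : overload (nd := nd) np L E w = ⋃ k, {p | E < ∑ j, ‖p.1.2 j (k, w k)‖ ^ 2} := by
    ext p
    simp [overload]
  rw [h]
  exact MeasurableSet.iUnion fun k => measurableSet_lt measurable_const (by fun_prop)

-- Borel structures of nested products, recorded to keep instance search shallow.
instance : BorelSpace ((Fin np → Fin L → ℂ) × (Fin nd → Fin L → ℂ)) := inferInstance

instance : SecondCountableTopology ((Fin np → Fin L → ℂ) × (Fin nd → Fin L → ℂ)) := inferInstance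

instance : BorelSpace (Codebooks nd K M × (Fin np → Fin L → ℂ) × (Fin nd → Fin L → ℂ)) :=
  inferInstance

instance : SecondCountableTopology
    (Codebooks nd K M × (Fin np → Fin L → ℂ) × (Fin nd → Fin L → ℂ)) := inferInstance

instance : BorelSpace (Observation np nd K M L) := Prod.borelSpace

lemma measurable_dec_cleanObservation {dec : Observation np nd K M L → Fin K → Fin M}
    (hdec : Measurable dec) (w : Fin K → Fin M) :
    Measurable fun p : (Pilots np K × Codebooks nd K M) × Noise np nd K L =>
      dec (cleanObservation p.1.1 p.1.2 w p.2) :=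
  hdec.comp (continuous_cleanObservation w).measurable

lemma measurableSet_errorCount (E : ℝ) {dec : Observation np nd K M L → Fin K → Fin M}
    (hdec : Measurable dec) (t : ℕ) (w : Fin K → Fin M) :
    MeasurableSet (errorCount E dec t w) := by
  refine (measurableSet_overload E w).compl.inter ?_
  exact measurable_dec_cleanObservation hdec w (MeasurableSet.of_discrete
    (s := {v : Fin K → Fin M | (Finset.univ.filter fun k => w k ≠ v k).card = t}))

lemma measurableSet_userError (E : ℝ) {dec : Observation np nd K M L → Fin K → Fin M}
    (hdec : Measurable dec) (k : Fin K) (w : Fin K → Fin M) :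
    MeasurableSet (userError E dec k w) := by
  refine (measurableSet_overload E w).compl.inter ?_
  exact measurable_dec_cleanObservation hdec w (MeasurableSet.of_discrete
    (s := {v : Fin K → Fin M | w k ≠ v k}))

lemma schemeLaw_overload_le (hnp : 1 ≤ np) (hM : 1 ≤ M) (hnd : 1 ≤ nd) (Pp : ℝ) {P' : ℝ}
    (hP' : 0 < P') (E : ℝ) :
    schemeLaw np nd K M L Pp P' (messageEvent (overload np L E)) ≤
      ENNReal.ofReal (p0 nd K P' E) := by
  have := isProbabilityMeasure_pilotLaw (K := K) hnp Pp
  refine schemeLaw_messageEvent_le hnp hM Pp P' (measurableSet_overload E) fun w => ?_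
  rw [← Measure.prod_apply (measurableSet_overload E w)]
  have hsub : overload (nd := nd) np L E w ⊆ ⋃ k ∈ (Finset.univ : Finset (Fin K)),
      ((Set.univ : Set (Pilots np K)) ×ˢ {a : Codebooks nd K M | E < ∑ j, ‖a j (k, w k)‖ ^ 2}) ×ˢ
        (Set.univ : Set (Noise np nd K L)) := by
    rintro p ⟨k, hk⟩
    simp only [Set.mem_iUnion]
    exact ⟨k, Finset.mem_univ k, ⟨⟨Set.mem_univ _, hk⟩, Set.mem_univ _⟩⟩
  refine (measure_mono hsub).trans ((measure_biUnion_finset_le _ _).trans ?_)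
  simp only [Measure.prod_prod, measure_univ, one_mul, mul_one, codebookLaw_energy_gt hnd hP',
    Finset.sum_const, Finset.card_univ, Fintype.card_fin, nsmul_eq_mul, p0]
  rw [ENNReal.ofReal_mul (Nat.cast_nonneg K), ENNReal.ofReal_natCast]

/-- Counting the wrongly decoded users in two ways. -/
lemma sum_schemeLaw_userError (E Pp P' : ℝ) {dec : Observation np nd K M L → Fin K → Fin M}
    (hdec : Measurable dec) :
    ∑ k, schemeLaw np nd K M L Pp P' (messageEvent (userError E dec k)) =
      ∑ t ∈ Finset.Icc 1 K, (t : ℝ≥0∞) *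
        schemeLaw np nd K M L Pp P' (messageEvent (errorCount E dec t)) := by
  have h1 : ∀ k, MeasurableSet (messageEvent (userError E dec k)) := fun k =>
    measurableSet_messageEvent (measurableSet_userError E hdec k)
  have h2 : ∀ t, MeasurableSet (messageEvent (errorCount E dec t)) := fun t =>
    measurableSet_messageEvent (measurableSet_errorCount E hdec t)
  simp_rw [← fun k => lintegral_indicator_one (μ := schemeLaw np nd K M L Pp P') (h1 k),
    ← fun t => lintegral_indicator_one (μ := schemeLaw np nd K M L Pp P') (h2 t)]
  simp_rw [← fun t : ℕ => lintegral_const_mul' (μ := schemeLaw np nd K M L Pp P') (t : ℝ≥0∞)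
    ((messageEvent (errorCount E dec t)).indicator 1) (ENNReal.natCast_ne_top t)]
  rw [← lintegral_finsetSum _ fun k _ => measurable_one.indicator (h1 k),
    ← lintegral_finsetSum _ fun t _ => (measurable_one.indicator (h2 t)).const_mul _]
  refine lintegral_congr fun ω => ?_
  by_cases hω : ((ω.1, ω.2.1), ω.2.2.2) ∈ overload (nd := nd) np L E ω.2.2.1
  · have e1 : ∀ k, ω ∉ messageEvent (userError E dec k) := fun k h => h.1 hω
    have e2 : ∀ t, ω ∉ messageEvent (errorCount E dec t) := fun t h => h.1 hω
    simp [e1, e2]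
  · set W := Finset.univ.filter fun k =>
      ω.2.2.1 k ≠ dec (cleanObservation ω.1 ω.2.1 ω.2.2.1 ω.2.2.2) k with hW
    have e1 : ∀ k, ω ∈ messageEvent (userError E dec k) ↔ k ∈ W := fun k => by
      rw [hW, Finset.mem_filter]
      exact ⟨fun h => ⟨Finset.mem_univ k, h.2⟩, fun h => ⟨hω, h.2⟩⟩
    have e2 : ∀ t, ω ∈ messageEvent (errorCount E dec t) ↔ W.card = t := fun t =>
      ⟨fun h => h.2, fun h => ⟨hω, h⟩⟩
    have i1 : ∀ k, (messageEvent (userError E dec k)).indicator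
          (1 : Sample np nd K M L → ℝ≥0∞) ω =
        if k ∈ W then 1 else 0 := fun k => by
      split_ifs with h
      · exact Set.indicator_of_mem ((e1 k).2 h) _
      · exact Set.indicator_of_notMem ((e1 k).not.2 h) _
    have i2 : ∀ t, (messageEvent (errorCount E dec t)).indicator
          (1 : Sample np nd K M L → ℝ≥0∞) ω =
        if W.card = t then 1 else 0 := fun t => by
      split_ifs with h
      · exact Set.indicator_of_mem ((e2 t).2 h) _
      · exact Set.indicator_of_notMem ((e2 t).not.2 h) _
    refine (Finset.sum_congr rfl fun k _ => i1 k).trans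
      (Eq.trans ?_ (Finset.sum_congr rfl fun t _ => congrArg _ (i2 t).symm))
    simp only [Finset.sum_ite_mem, Finset.univ_inter,
      Finset.sum_const, nsmul_eq_mul, mul_one, mul_ite, mul_zero, Finset.sum_ite_eq,
      Finset.mem_Icc]
    have hWK : W.card ≤ K := by simpa using Finset.card_le_univ W
    rcases Nat.eq_zero_or_pos W.card with h0 | h0
    · simp [h0]
    · rw [if_pos ⟨h0, hWK⟩]

/-- An erroneous user is accounted for by an overload, or by the errors without overload; the
latter are grouped by their number `t`, each group having probability at most `min(1, p_t)`. -/
theorem pupe_le_pupeBound (hnp : 1 ≤ np) (hL : 1 ≤ L) (hK : 1 ≤ K) (hM : 1 ≤ M) (hnd : 1 ≤ nd)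
    (Pp E : ℝ) {P' : ℝ} (hP' : 0 < P') {dec : Observation np nd K M L → Fin K → Fin M}
    (hdec : IsNearestNeighbour dec) {S : ℕ → Finset (Fin K)}
    (hS : ∀ t ∈ Finset.Icc 1 K, (S t).card = t) {w w' : Fin K → Fin M} (hw : ∀ k, w k ≠ w' k) :
    pupe Pp P' E dec ≤ pupeBound np nd L Pp P' E S w w' := by
  have := isProbabilityMeasure_schemeLaw (nd := nd) (K := K) (L := L) hnp hM Pp P'
  set μ := schemeLaw np nd K M L Pp P' with hμ
  have hK0 : (K : ℝ≥0∞) ≠ 0 := by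
    rw [Nat.cast_ne_zero]; omega
  have hsplit : ∀ k, μ {ω | ω.2.2.1 k ≠ dec (observe E ω) k} ≤
      μ (messageEvent (overload np L E)) + μ (messageEvent (userError E dec k)) := by
    intro k
    refine (measure_mono fun ω hω => ?_).trans (measure_union_le _ _)
    by_cases h : ω ∈ messageEvent (overload np L E)
    · exact Or.inl h
    · refine Or.inr ⟨h, ?_⟩
      have h2 : ∀ k, ∑ j, ‖ω.2.1 j (k, ω.2.2.1 k)‖ ^ 2 ≤ E := fun k => by
        by_contra hcon
        exact h ⟨k, not_le.1 hcon⟩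
      have h3 : observe E ω = cleanObservation ω.1 ω.2.1 ω.2.2.1 ω.2.2.2 := by
        obtain ⟨b, a, v, H, Zp, Zd⟩ := ω
        simp only [observe, cleanObservation, transmitted_eq_selected h2]
      rw [Set.mem_ofPred_eq, h3] at hω
      exact hω
  have hterm : ∀ t ∈ Finset.Icc 1 K, μ (messageEvent (errorCount E dec t)) ≤
      min 1 (pt np nd L Pp P' t (S t) w w') := by
    intro t ht
    refine le_min prob_le_one (schemeLaw_messageEvent_le hnp hM Pp P'
      (measurableSet_errorCount E hdec.1 t) fun w₀ => ?_)
    refine le_trans (lintegral_mono fun x => measure_mono fun z hz => ?_)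
      (lintegral_error_le_pt hnp hL hK hnd Pp P' (hS t ht) hw hdec w₀)
    exact hz.2
  calc pupe Pp P' E dec
      ≤ (K : ℝ≥0∞)⁻¹ * ∑ k : Fin K, (μ (messageEvent (overload np L E)) +
          μ (messageEvent (userError E dec k))) :=
        mul_le_mul_right (Finset.sum_le_sum fun k _ => hsplit k) _
    _ = μ (messageEvent (overload np L E)) + ∑ t ∈ Finset.Icc 1 K, ((t : ℝ≥0∞) / (K : ℝ≥0∞)) *
          μ (messageEvent (errorCount E dec t)) := by
        rw [Finset.sum_add_distrib, Finset.sum_const, Finset.card_univ, Fintype.card_fin,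
          nsmul_eq_mul, mul_add, ← mul_assoc, ENNReal.inv_mul_cancel hK0 (ENNReal.natCast_ne_top K),
          one_mul, hμ, sum_schemeLaw_userError E Pp P' hdec.1, Finset.mul_sum]
        congr 1
        refine Finset.sum_congr rfl fun t _ => ?_
        rw [div_eq_mul_inv, ← mul_assoc, mul_comm ((K : ℝ≥0∞)⁻¹)]
    _ ≤ _ := by
        refine add_le_add (schemeLaw_overload_le hnp hM hnd Pp hP' E)
          (Finset.sum_le_sum fun t ht => ?_)
        exact mul_le_mul_right (hterm t ht) _

end Scheme

/-! ### Orthogonal pilots -/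

section OrthogonalPilots

open Matrix

variable {np K : ℕ}

lemma sigma_of_orthogonal {b : Pilots np K} {c : ℝ} (hc : 0 ≤ c) (hb : ∀ i, ‖b i‖ ^ 2 = c)
    (horth : ∀ i j, i ≠ j → inner ℂ (b i) (b j) = 0) :
    sigmaHat (pilotMatrix b) = ((c / (1 + c) : ℝ) : ℂ) • (1 : Matrix (Fin K) (Fin K) ℂ) ∧
      sigmaTilde (pilotMatrix b) = ((1 / (1 + c) : ℝ) : ℂ) • (1 : Matrix (Fin K) (Fin K) ℂ) := by
  have hc1 : (1 : ℝ) + c ≠ 0 := by positivity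
  have hgram : 1 + (pilotMatrix b)ᴴ * pilotMatrix b =
      ((1 + c : ℝ) : ℂ) • (1 : Matrix (Fin K) (Fin K) ℂ) := by
    ext i j
    have h : ((pilotMatrix b)ᴴ * pilotMatrix b) i j = inner ℂ (b i) (b j) := by
      simp [Matrix.mul_apply, pilotMatrix, PiLp.inner_apply, mul_comm]
    rw [Matrix.add_apply, h]
    rcases eq_or_ne i j with rfl | hij
    · rw [inner_self_eq_norm_sq_to_K, ← Complex.coe_algebraMap, ← map_pow, hb]
      simp
    · rw [horth i j hij]
      simp [hij]
  have hinv : (1 + (pilotMatrix b)ᴴ * pilotMatrix b)⁻¹ =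
      ((1 / (1 + c) : ℝ) : ℂ) • (1 : Matrix (Fin K) (Fin K) ℂ) := by
    refine Matrix.inv_eq_right_inv ?_
    rw [hgram, Matrix.smul_mul, Matrix.one_mul, smul_smul, ← Complex.ofReal_mul,
      mul_one_div_cancel hc1, Complex.ofReal_one, one_smul]
  refine ⟨?_, hinv⟩
  have hc2 : c / (1 + c) = 1 - 1 / (1 + c) := by
    field_simp
    ring
  rw [sigmaHat, hinv, hc2, Complex.ofReal_sub, Complex.ofReal_one, sub_smul, one_smul]

end OrthogonalPilots

end PilotAccess

theorem mainTheorem10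
    (n np nd K J M L : ℕ) (P Pp : ℝ)
    (hK : 1 ≤ K) (hL : 1 ≤ L) (hJ : 1 ≤ J) (hM : M = 2 ^ J)
    (hnp : 1 ≤ np) (hnpK : np ≤ K) (hnd : 1 ≤ nd) (hn : n = np + nd)
    (hPp : 0 ≤ Pp) (hpow : np * Pp ≤ n * P)
    (dec : PilotAccess.Observation np nd K M L → Fin K → Fin M)
    (hdec : PilotAccess.IsNearestNeighbour dec)
    (S : ℕ → Finset (Fin K)) (hS : ∀ t ∈ Finset.Icc 1 K, (S t).card = t)
    (w w' : Fin K → Fin M) (hw : ∀ k, w k ≠ w' k) :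
    (∀ P' : ℝ, 0 < P' → P' < P →
      PilotAccess.pupe Pp P' (n * P - np * Pp) dec ≤
        PilotAccess.pupeBound np nd L Pp P' (n * P - np * Pp) S w w') ∧
    (⨅ P' ∈ Set.Ioo 0 P, PilotAccess.pupe Pp P' (n * P - np * Pp) dec) ≤
      (⨅ P' ∈ Set.Ioo 0 P, PilotAccess.pupeBound np nd L Pp P' (n * P - np * Pp) S w w') ∧
    (np = K → ∀ b : PilotAccess.Pilots np K,
      (∀ i, ‖b i‖ ^ 2 = np * Pp) → (∀ i j, i ≠ j → inner ℂ (b i) (b j) = 0) →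
        PilotAccess.sigmaHat (PilotAccess.pilotMatrix b) =
            ((np * Pp / (1 + np * Pp) : ℝ) : ℂ) • (1 : Matrix (Fin K) (Fin K) ℂ) ∧
          PilotAccess.sigmaTilde (PilotAccess.pilotMatrix b) =
            ((1 / (1 + np * Pp) : ℝ) : ℂ) • (1 : Matrix (Fin K) (Fin K) ℂ)) := by
  have hM1 : 1 ≤ M := hM ▸ Nat.one_le_two_pow
  have h1 : ∀ P' : ℝ, 0 < P' → P' < P →
      PilotAccess.pupe Pp P' (n * P - np * Pp) dec ≤
        PilotAccess.pupeBound np nd L Pp P' (n * P - np * Pp) S w w' := fun P' hP' _ =>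
    PilotAccess.pupe_le_pupeBound hnp hL hK hM1 hnd Pp _ hP' hdec hS hw
  refine ⟨h1, iInf₂_mono fun P' hP' => h1 P' hP'.1 hP'.2, fun _ b hb horth => ?_⟩
  exact PilotAccess.sigma_of_orthogonal (by positivity) hb horth
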